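/- Graphs are finite multigraphs (loops and parallel edges allowed). For a connected graph $H$, the genus law $\gamma_H$ (resp. Euler-genus law $\varepsilon_H$) is the random variable giving the genus (resp. Euler-genus) of a uniform random cellular embedding of $H$ in an orientable closed surface (resp. in an arbitrary closed surface, orientable or not). Here the embeddings in orientable surfaces are encoded by rotation systems, and the embeddings in arbitrary surfaces by signed rotation systems (a rotation system together with a set of twisted edges). Let $\gamma_{\min}(H),\gamma_{\max}(H)$ (resp. $\varepsilon_{\min}(H),\varepsilon_{\max}(H)$) be the minimum and maximum genus (resp. Euler-genus) over these embeddings. The bar-amalgamation $G\oplus_{uv}H$ of two graphs along a vertex $u$ of $G$ and a vertex $v$ of $H$ is obtained from their disjoint union by adding a new edge $\{u,v\}$. **Theorem.** Let $(H_n)_{n\ge 1}$ be a sequence of connected graphs, each with at most $M$ edges for some fixed $M$. Let $(G_n)_{n\ge1}$ be a sequence of tree-like graphs built from it, that is, $G_1=H_1$ and, for each $n>1$, $G_n=G_{n-1}\oplus_{uv}H_n$ for some vertex $u$ of $G_{n-1}$ and some vertex $v$ of $H_n$ (both may depend on $n$). 1. If $\gamma_{\max}(H_n)>\gamma_{\min}(H_n)$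 for infinitely many $n$, then $(\gamma_{G_n})_{n\ge1}$ is asymptotically normal, i.e. the cumulative distribution function of $(\gamma_{G_n}-\mathbb E\,\gamma_{G_n})/\sqrt{\operatorname{Var}\gamma_{G_n}}$ converges pointwise to that of the standard normal law $\mathcal N(0,1)$. 2. If $\varepsilon_{\max}(H_n)>\varepsilon_{\min}(H_n)$ for infinitely many $n$, then $(\varepsilon_{G_n})_{n\ge1}$ is asymptotically normal in the same sense. -/

import Mathlib

open scoped Graph

namespace GraphEmbedding

open MeasureTheory ProbabilityTheory Filter

/-! Graphs are Mathlib's multigraphs `Graph α β`: loops and parallel edges are allowed. -/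

section Graphs

variable {α β α' β' : Type*}

/-- A graph is connected if it has a vertex and any two vertices are joined by a walk. -/
def Connected (G : Graph α β) : Prop :=
  V(G).Nonempty ∧ ∀ x ∈ V(G), ∀ y ∈ V(G), Relation.ReflTransGen G.Adj x y

/-- An isomorphism of multigraphs. -/
structure Iso (G : Graph α β) (H : Graph α' β') where
  vertexEquiv : V(G) ≃ V(H)
  edgeEquiv : E(G) ≃ E(H)
  isLink_iff : ∀ (e : E(G)) (x y : V(G)),
    H.IsLink (edgeEquiv e) (vertexEquiv x) (vertexEquiv y) ↔ G.IsLink e x y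

/-- Incidence in the bar-amalgamation: the edges of `G`, the edges of `H`, and one new edge
`none` that joins `u` to `v`. -/
def barLink (G : Graph α β) (H : Graph α' β') (u : V(G)) (v : V(H)) :
    Option (β ⊕ β') → α ⊕ α' → α ⊕ α' → Prop
  | some (.inl e), .inl x, .inl y => G.IsLink e x y
  | some (.inr e), .inr x, .inr y => H.IsLink e x y
  | none, .inl x, .inr y => x = u ∧ y = v
  | none, .inr y, .inl x => x = u ∧ y = v
  | _, _, _ => False

/-- The bar-amalgamation of `G` and `H` along the vertices `u` of `G` and `v` of `H`: the disjoint
union of `G` and `H` together with a new edge joining `u` and `v`. -/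
def barAmalgamation (G : Graph α β) (H : Graph α' β') (u : V(G)) (v : V(H)) :
    Graph (α ⊕ α') (Option (β ⊕ β')) where
  vertexSet := Sum.inl '' V(G) ∪ Sum.inr '' V(H)
  IsLink := barLink G H u v
  isLink_symm := by
    intro e _
    refine ⟨?_⟩
    rintro (x | x) (y | y) h <;> rcases e with _ | e | e <;> simp only [barLink] at h ⊢
    all_goals first | exact h | exact h.symm
  eq_or_eq_of_isLink_of_isLink := by
    rintro (_ | e | e) (x | x) (y | y) (z | z) (w | w) h h' <;>
      simp only [barLink] at h h' <;> simp only [Sum.inl.injEq, Sum.inr.injEq]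
    all_goals first
      | exact h.left_eq_or_eq h'
      | exact Or.inl (h.1.trans h'.1.symm)
      | exact Or.inl (h.2.trans h'.2.symm)
      | exact Or.inr (h.1.trans h'.1.symm)
      | exact Or.inr (h.2.trans h'.2.symm)
  left_mem_of_isLink := by
    rintro (_ | e | e) (x | x) (y | y) h <;> simp only [barLink] at h
    · exact Or.inl ⟨x, h.1 ▸ u.2, rfl⟩
    · exact Or.inr ⟨x, h.2 ▸ v.2, rfl⟩
    · exact Or.inl ⟨x, h.left_mem, rfl⟩
    · exact Or.inr ⟨x, h.left_mem, rfl⟩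

/-- `G 0, G 1, …` is a sequence of tree-like graphs built from `H 0, H 1, …` by successive
bar-amalgamations: up to isomorphism, `G 0` is `H 0`, and `G (n + 1)` is a bar-amalgamation of
`G n` and `H (n + 1)` along an arbitrary pair of vertices. -/
def IsTreeLikeSequence (H : ℕ → Graph α β) (G : ℕ → Graph α' β') : Prop :=
  Nonempty (Iso (G 0) (H 0)) ∧
    ∀ n, ∃ (u : V(G n)) (v : V(H (n + 1))),
      Nonempty (Iso (G (n + 1)) (barAmalgamation (G n) (H (n + 1)) u v))

end Graphs

section Embeddings

variable {α β : Type*} (G : Graph α β)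

/-- The darts of `G`: every edge, loop or not, has two darts, `(e, false)` and `(e, true)`. -/
abbrev Dart : Type _ := E(G) × Bool

variable {G} in
/-- The first of the two ends of an edge, in an arbitrary order. -/
noncomputable def firstEnd (e : E(G)) : α :=
  (G.exists_isLink_of_mem_edgeSet e.2).choose

variable {G} in
/-- The second of the two ends of an edge, in an arbitrary order. -/
noncomputable def secondEnd (e : E(G)) : α :=
  (G.exists_isLink_of_mem_edgeSet e.2).choose_spec.choose

theorem isLink_firstEnd_secondEnd (e : E(G)) : G.IsLink e (firstEnd e) (secondEnd e) :=
  (G.exists_isLink_of_mem_edgeSet e.2).choose_spec.choose_spec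

variable {G} in
/-- The vertex of a dart. The two darts of an edge are located at its two ends (both at the same
vertex for a loop); which of them is called `(e, false)` is irrelevant. -/
noncomputable def dartVertex (d : Dart G) : V(G) :=
  if d.2 then ⟨secondEnd d.1, (isLink_firstEnd_secondEnd G d.1).right_mem⟩
  else ⟨firstEnd d.1, (isLink_firstEnd_secondEnd G d.1).left_mem⟩

/-- The involution `τ` exchanging the two darts of each edge. -/
def dartFlip : Equiv.Perm (Dart G) :=
  (Equiv.refl _).prodCongr Equiv.boolNot

/-- The number of cycles of a permutation, fixed points included. -/
noncomputable def numCycles {D : Type*} (f : Equiv.Perm D) : ℕ :=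
  Nat.card (Quotient (Equiv.Perm.SameCycle.setoid f))

/-- The number of vertices without darts. In a connected graph this is `0`, unless the graph
is a single vertex without edges, whose only cellular embedding has one face. -/
noncomputable def numIsolated : ℕ :=
  Nat.card {v : V(G) // ∀ d : Dart G, dartVertex d ≠ v}

/-- A rotation system: a permutation `σ` of the darts having, for each vertex that carries a dart,
exactly one cycle consisting of all the darts at that vertex. Rotation systems encode the cellular
embeddings of `G` in oriented surfaces. -/
def RotationSystem : Type _ :=
  {σ : Equiv.Perm (Dart G) // ∀ d d', σ.SameCycle d d' ↔ dartVertex d = dartVertex d'}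

/-- A signed rotation system: a rotation system together with the set of twisted edges
(those mapped to `true`). Signed rotation systems encode the cellular embeddings of `G` in
arbitrary closed surfaces; for a connected graph with `v` vertices, each embedding, as counted by
the Euler-genus polynomial, is encoded by the same number `2 ^ (v - 1)` of signed rotation
systems. -/
def SignedRotationSystem : Type _ :=
  RotationSystem G × (E(G) → Bool)

instance : MeasurableSpace (RotationSystem G) := ⊤

instance : MeasurableSpace (SignedRotationSystem G) := ⊤

variable {G}

/-- The number of faces of the embedding given by a rotation system: the cycles of `σ τ`. -/
noncomputable def RotationSystem.numFaces (R : RotationSystem G) : ℕ :=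
  numCycles (R.1 * dartFlip G) + numIsolated G

/-- The signed permutation of the darts `(d, false)` and their opposites `(d, true)` given by the
rotation: it turns in the opposite direction on the opposite darts. -/
def SignedRotationSystem.sigma (S : SignedRotationSystem G) : Equiv.Perm (Dart G × Bool) where
  toFun x := (if x.2 then S.1.1.symm x.1 else S.1.1 x.1, x.2)
  invFun x := (if x.2 then S.1.1 x.1 else S.1.1.symm x.1, x.2)
  left_inv := by rintro ⟨d, _ | _⟩ <;> simp
  right_inv := by rintro ⟨d, _ | _⟩ <;> simp

/-- The signed involution exchanging the two darts of each edge, which changes the sign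
exactly at the twisted edges. -/
def SignedRotationSystem.tau (S : SignedRotationSystem G) : Equiv.Perm (Dart G × Bool) where
  toFun x := (dartFlip G x.1, xor x.2 (S.2 x.1.1))
  invFun x := (dartFlip G x.1, xor x.2 (S.2 x.1.1))
  left_inv := by rintro ⟨⟨e, b⟩, s⟩; simp [dartFlip]
  right_inv := by rintro ⟨⟨e, b⟩, s⟩; simp [dartFlip]

/-- The number of faces of the embedding given by a signed rotation system, as a real number:
every face boundary is traversed in both directions, by two different cycles. -/
noncomputable def SignedRotationSystem.numFaces (S : SignedRotationSystem G) : ℝ :=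
  (numCycles (S.sigma * S.tau) : ℝ) / 2 + numIsolated G

/-- The genus `k` of the orientable surface, from Euler's formula `v - e + f = 2 - 2 k`. -/
noncomputable def RotationSystem.genus (R : RotationSystem G) : ℝ :=
  (2 - ((Nat.card V(G) : ℝ) - Nat.card E(G) + R.numFaces)) / 2

/-- The Euler-genus `ε` of the surface, from Euler's formula `v - e + f = 2 - ε`. -/
noncomputable def SignedRotationSystem.eulerGenus (S : SignedRotationSystem G) : ℝ :=
  2 - ((Nat.card V(G) : ℝ) - Nat.card E(G) + S.numFaces)

variable (G)

/-- The minimum genus of `G`. -/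
noncomputable def minGenus : ℕ := sInf {i : ℕ | ∃ R : RotationSystem G, R.genus = i}

/-- The maximum genus of `G`. -/
noncomputable def maxGenus : ℕ := sSup {i : ℕ | ∃ R : RotationSystem G, R.genus = i}

/-- The minimum Euler-genus of `G`. -/
noncomputable def minEulerGenus : ℕ :=
  sInf {i : ℕ | ∃ S : SignedRotationSystem G, S.eulerGenus = i}

/-- The maximum Euler-genus of `G`. -/
noncomputable def maxEulerGenus : ℕ :=
  sSup {i : ℕ | ∃ S : SignedRotationSystem G, S.eulerGenus = i}

/-- The genus law of `G`: the law of the genus of a uniform random cellular embedding of `G` in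
an orientable surface. -/
noncomputable def genusLaw : Measure ℝ :=
  (uniformOn (Set.univ : Set (RotationSystem G))).map RotationSystem.genus

/-- The Euler-genus law of `G`: the law of the Euler-genus of a uniform random cellular embedding
of `G`, orientable or not. -/
noncomputable def eulerGenusLaw : Measure ℝ :=
  (uniformOn (Set.univ : Set (SignedRotationSystem G))).map SignedRotationSystem.eulerGenus

end Embeddings

/-- The law of `(X - 𝔼 X) / √(Var X)` when `X` has law `μ`. -/
noncomputable def standardize (μ : Measure ℝ) : Measure ℝ :=
  μ.map fun x => (x - ∫ y, y ∂μ) / √(variance id μ)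

/-- Random variables with laws `μ 0, μ 1, …` are asymptotically normal: the cumulative
distribution functions of the standardized variables converge pointwise to that of the
standard normal law. -/
def AsymptoticallyNormal (μ : ℕ → Measure ℝ) : Prop :=
  ∀ x : ℝ, Tendsto (fun n => (standardize (μ n)).real (Set.Iic x)) atTop
    (nhds ((gaussianReal 0 1).real (Set.Iic x)))

end GraphEmbedding

/-!
The genus law of a bar-amalgamation is the convolution of the genus laws of its two parts, so the
genus of `G n` is distributed as a sum of independent variables, one for each of `H 0, …, H n`.
These take values in intervals of a length bounded in terms of `M`; if two values of a summand
differ by at least `1`, its variance is bounded below in terms of `M`, because there are boundedly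
many rotation systems. Hence the variance of the sum tends to infinity, and the central limit
theorem for bounded independent summands applies. The Euler-genus is treated in the same way.

*Convolution* (`laws_of_bar`). A rotation system of the bar-amalgamation consists of rotation
systems of the two parts together with the place where each of the two darts of the new edge is
inserted, independently of the rest (`rotationBar`). Inserting a dart into a rotation lengthens a
cycle of the face permutation, or creates one at a vertex without darts, which so far counted as a
face. Joining the two new darts by an edge amounts to composing the face permutation with a
transposition of points on cycles of different parts, which merges two faces (`faceCount_bar`).
For signed rotation systems each face is a pair of cycles, and the new edge contributes two
transpositions, the second of which still merges two different cycles since a face boundary and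
its reversal are never the same cycle (`not_sameCycle_reverse`, `signedFaceCount_bar`). So the
number of faces is `f₁ + f₂ - 1`, and by Euler's formula the genus and the Euler-genus are
additive.

*Central limit theorem* (`asymptoticallyNormal_of_conv`). For a centered variable bounded by `C`
with variance `v`, the characteristic function at `u` is within `2 C |u|³ v` of `exp (-u² v / 2)`
once `|u| C ≤ 1`. At `u = t / s`, where `s²` is the sum of the variances, these errors add up to
`2 C |t|³ / s`, which tends to `0`; Lévy's convergence theorem concludes.
-/

namespace GraphEmbedding

open MeasureTheory ProbabilityTheory Filter
open scoped Topology

/-! ### A central limit theorem for convolutions of uniformly bounded laws -/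

section CentralLimit

/-- The characteristic function of `X - 𝔼 X` when `X` has law `μ`. -/
noncomputable def centeredCharFun (μ : Measure ℝ) (u : ℝ) : ℂ :=
  charFun (μ.map fun x => x - ∫ y, y ∂μ) u

theorem charFun_standardize (μ : Measure ℝ) (t : ℝ) :
    charFun (standardize μ) t = centeredCharFun μ ((√(variance id μ))⁻¹ * t) := by
  have h : standardize μ = (μ.map fun x => x - ∫ y, y ∂μ).map ((√(variance id μ))⁻¹ * ·) := by
    rw [Measure.map_map (by fun_prop) (by fun_prop), standardize]
    congr 1
    funext x
    simp [div_eq_inv_mul]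
  rw [h, charFun_map_mul, centeredCharFun]

theorem centeredCharFun_eq (μ : Measure ℝ) (u : ℝ) :
    centeredCharFun μ u = charFun μ u * Complex.exp (-((∫ y, y ∂μ) * u * Complex.I)) := by
  simp only [centeredCharFun, sub_eq_add_neg]
  rw [charFun_map_add_const]
  congr 2
  simp
  ring

theorem integral_id_conv {μ ν : Measure ℝ} [IsProbabilityMeasure μ] [IsProbabilityMeasure ν]
    (hμ : MemLp id 2 μ) (hν : MemLp id 2 ν) :
    ∫ y, y ∂(μ ∗ ν) = (∫ y, y ∂μ) + ∫ y, y ∂ν := by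
  have h1 : Integrable (fun x : ℝ => x) μ := hμ.integrable (by norm_num)
  have h2 : Integrable (fun x : ℝ => x) ν := hν.integrable (by norm_num)
  rw [Measure.conv, integral_map (by fun_prop) (by fun_prop),
    integral_add (h1.comp_fst ν) (h2.comp_snd μ), integral_fun_fst (fun x : ℝ => x),
    integral_fun_snd (fun x : ℝ => x)]
  simp

theorem centeredCharFun_conv {μ ν : Measure ℝ} [IsProbabilityMeasure μ] [IsProbabilityMeasure ν]
    (hμ : MemLp id 2 μ) (hν : MemLp id 2 ν) (u : ℝ) :
    centeredCharFun (μ ∗ ν) u = centeredCharFun μ u * centeredCharFun ν u := by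
  rw [centeredCharFun_eq, centeredCharFun_eq, centeredCharFun_eq, charFun_conv,
    integral_id_conv hμ hν, mul_mul_mul_comm, ← Complex.exp_add]
  congr 2
  push_cast
  ring

theorem variance_id_conv {μ ν : Measure ℝ} [IsProbabilityMeasure μ] [IsProbabilityMeasure ν]
    (hμ : MemLp id 2 μ) (hν : MemLp id 2 ν) :
    variance id (μ ∗ ν) = variance id μ + variance id ν := by
  have e : μ ∗ ν = (μ.prod ν).map fun z => z.1 + z.2 := rfl
  rw [e, variance_id_map (by fun_prop)]
  exact variance_add_prod (X := id) (Y := id) hμ hν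

theorem memLp_id_conv {μ ν : Measure ℝ} [IsProbabilityMeasure μ] [IsProbabilityMeasure ν]
    (hμ : MemLp id 2 μ) (hν : MemLp id 2 ν) : MemLp id 2 (μ ∗ ν) := by
  have h1 : MemLp (fun z : ℝ × ℝ => z.1) 2 (μ.prod ν) := hμ.comp_measurePreserving
    measurePreserving_fst
  have h2 : MemLp (fun z : ℝ × ℝ => z.2) 2 (μ.prod ν) := hν.comp_measurePreserving
    measurePreserving_snd
  have e : μ ∗ ν = (μ.prod ν).map fun z => z.1 + z.2 := rfl
  rw [e, memLp_map_measure_iff (by fun_prop) (by fun_prop)]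
  exact MemLp.add h1 h2

/-- A law carried by an interval of length `C` is, after centering, carried by `[-C, C]`. -/
theorem ae_abs_sub_integral_le {μ : Measure ℝ} [IsProbabilityMeasure μ] {a C : ℝ}
    (h : ∀ᵐ x ∂μ, x ∈ Set.Icc a (a + C)) : ∀ᵐ x ∂μ, |x - ∫ y, y ∂μ| ≤ C := by
  have hi : Integrable (fun x : ℝ => x) μ := Integrable.of_mem_Icc a (a + C) (by fun_prop) h
  have h1 : a ≤ ∫ y, y ∂μ := by
    have := integral_mono_ae (integrable_const a) hi (h.mono fun x hx => hx.1)
    simpa using this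
  have h2 : ∫ y, y ∂μ ≤ a + C := by
    have := integral_mono_ae hi (integrable_const (a + C)) (h.mono fun x hx => hx.2)
    simpa using this
  filter_upwards [h] with x hx
  rw [abs_le]
  constructor <;> linarith [hx.1, hx.2]

theorem memLp_id_of_ae_mem_Icc {μ : Measure ℝ} [IsProbabilityMeasure μ] {a b : ℝ}
    (h : ∀ᵐ x ∂μ, x ∈ Set.Icc a b) : MemLp id 2 μ :=
  memLp_of_bounded h (by fun_prop) 2

/-- Second order Taylor expansion of the characteristic function of a centered bounded variable;
boundedness turns the third moment into the variance. -/
theorem norm_centeredCharFun_sub_le {μ : Measure ℝ} [IsProbabilityMeasure μ] {a C u : ℝ}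
    (h : ∀ᵐ x ∂μ, x ∈ Set.Icc a (a + C)) (hu : |u| * C ≤ 1) :
    ‖centeredCharFun μ u - (1 - u ^ 2 * variance id μ / 2 : ℝ)‖ ≤ C * |u| ^ 3 * variance id μ := by
  set m := ∫ y, y ∂μ with hm
  have hb := ae_abs_sub_integral_le h
  rw [← hm] at hb
  have hL := memLp_id_of_ae_mem_Icc h
  have hi : Integrable (fun x : ℝ => x) μ := hL.integrable (by norm_num)
  have hL' : MemLp (fun x : ℝ => x - m) 2 μ := hL.sub (memLp_const m)
  have hi2 : Integrable (fun x : ℝ => (x - m) ^ 2) μ := hL'.integrable_sq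
  have hi1 : Integrable (fun x : ℝ => x - m) μ := hi.sub (integrable_const m)
  have hv : variance id μ = ∫ x, (x - m) ^ 2 ∂μ := by
    rw [variance_eq_integral (by fun_prop)]; rfl
  have h0 : ∫ x, (x - m) ∂μ = 0 := by
    rw [integral_sub hi (integrable_const m)]; simp [hm]
  have e1 : centeredCharFun μ u = ∫ x, Complex.exp (u * (x - m : ℝ) * Complex.I) ∂μ := by
    rw [centeredCharFun, charFun_apply_real, integral_map (by fun_prop) (by fun_prop)]
  have hint : Integrable (fun x : ℝ => Complex.exp (u * (x - m : ℝ) * Complex.I)) μ := by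
    refine Integrable.of_bound (by fun_prop) 1 (ae_of_all _ fun x => ?_)
    rw [← Complex.ofReal_mul, Complex.norm_exp_ofReal_mul_I]
  have hq1 : Integrable (fun x : ℝ => (u * (x - m : ℝ) * Complex.I : ℂ)) μ :=
    (hi1.ofReal.const_mul _).mul_const _
  have hq2 : Integrable (fun x : ℝ => ((u ^ 2 * (x - m) ^ 2 / 2 : ℝ) : ℂ)) μ :=
    ((hi2.const_mul _).div_const _).ofReal
  have hq3 : Integrable (fun x : ℝ => (1 + (u * (x - m : ℝ) * Complex.I) : ℂ)) μ :=
    (integrable_const _).add hq1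
  have hq4 : Integrable (fun x : ℝ => (1 + (u * (x - m : ℝ) * Complex.I)
      - ((u ^ 2 * (x - m) ^ 2 / 2 : ℝ) : ℂ) : ℂ)) μ := hq3.sub hq2
  have e2 : ((1 - u ^ 2 * variance id μ / 2 : ℝ) : ℂ)
      = ∫ x, (1 + (u * (x - m : ℝ) * Complex.I : ℂ) - ((u ^ 2 * (x - m) ^ 2 / 2 : ℝ) : ℂ)) ∂μ := by
    rw [integral_sub hq3 hq2, integral_add (integrable_const _) hq1,
      integral_mul_const, integral_const_mul, integral_complex_ofReal, h0, integral_complex_ofReal, integral_div,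
      integral_const_mul, ← hv]
    simp
  rw [e1, e2, ← integral_sub hint hq4, hv,
    ← integral_const_mul]
  refine norm_integral_le_of_norm_le (hi2.const_mul _) ?_
  filter_upwards [hb] with x hx
  have hn : ‖(u * (x - m : ℝ) * Complex.I : ℂ)‖ = |u| * |x - m| := by
    simp [-Complex.ofReal_sub]
  have hle : |u| * |x - m| ≤ 1 :=
    (mul_le_mul_of_nonneg_left hx (abs_nonneg u)).trans hu
  have key := Complex.exp_bound (x := (u * (x - m : ℝ) * Complex.I : ℂ)) (n := 3)
    (by rw [hn]; exact hle) (by norm_num)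
  rw [hn] at key
  have hs : ∑ k ∈ Finset.range 3, (u * (x - m : ℝ) * Complex.I : ℂ) ^ k / (k.factorial : ℂ)
      = 1 + (u * (x - m : ℝ) * Complex.I : ℂ) - ((u ^ 2 * (x - m) ^ 2 / 2 : ℝ) : ℂ) := by
    simp [Finset.sum_range_succ, Nat.factorial, mul_pow, Complex.I_sq]
    ring
  rw [hs] at key
  refine key.trans ?_
  have h3 : (|u| * |x - m|) ^ 3 = |u| ^ 3 * (|x - m| * (x - m) ^ 2) := by
    rw [← sq_abs (x - m)]; ring
  have h4 : |u| ^ 3 * (|x - m| * (x - m) ^ 2) ≤ |u| ^ 3 * (C * (x - m) ^ 2) := by gcongr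
  have h5 : 0 ≤ |u| ^ 3 * (|x - m| * (x - m) ^ 2) := by positivity
  rw [h3]
  have h6 : ((3 : ℕ).succ : ℝ) * (((3 : ℕ).factorial : ℝ) * (3 : ℕ))⁻¹ ≤ 1 := by
    norm_num [Nat.factorial]
  calc _ ≤ |u| ^ 3 * (|x - m| * (x - m) ^ 2) * 1 := mul_le_mul_of_nonneg_left h6 h5
    _ ≤ _ := by rw [mul_one]; linarith

theorem variance_le_sq_of_ae_mem_Icc {μ : Measure ℝ} [IsProbabilityMeasure μ] {a C : ℝ}
    (h : ∀ᵐ x ∂μ, x ∈ Set.Icc a (a + C)) : variance id μ ≤ C ^ 2 := by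
  have := variance_le_sq_of_bounded (X := id) h (by fun_prop)
  refine this.trans ?_
  nlinarith [sq_nonneg C]

/-- Comparison with the characteristic function of the normal law of the same variance. The second
order term of the exponential is absorbed because the variance is at most `C ^ 2`. -/
theorem norm_centeredCharFun_sub_exp_le {μ : Measure ℝ} [IsProbabilityMeasure μ] {a C u : ℝ}
    (hC : 0 ≤ C) (h : ∀ᵐ x ∂μ, x ∈ Set.Icc a (a + C)) (hu : |u| * C ≤ 1) :
    ‖centeredCharFun μ u - (Real.exp (-(u ^ 2 * variance id μ / 2)) : ℝ)‖
      ≤ 2 * C * |u| ^ 3 * variance id μ := by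
  have h1 := norm_centeredCharFun_sub_le h hu
  have hv := variance_le_sq_of_ae_mem_Icc h
  have hv0 := variance_nonneg id μ
  set v := variance id μ
  have hle1 : u ^ 2 * v ≤ (|u| * C) ^ 2 := by
    rw [mul_pow, sq_abs]; gcongr
  have hle2 : (|u| * C) ^ 2 ≤ |u| * C := by
    rw [sq]; exact mul_le_of_le_one_left (by positivity) hu
  have hy0 : 0 ≤ u ^ 2 * v := by positivity
  have h2 : ‖Real.exp (-(u ^ 2 * v / 2)) - 1 - -(u ^ 2 * v / 2)‖ ≤ ‖-(u ^ 2 * v / 2)‖ ^ 2 := by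
    apply Real.norm_exp_sub_one_sub_id_le
    rw [norm_neg, Real.norm_of_nonneg (by positivity)]
    linarith
  rw [norm_neg, Real.norm_of_nonneg (by positivity : 0 ≤ u ^ 2 * v / 2)] at h2
  have h3 : (u ^ 2 * v / 2) ^ 2 ≤ C * |u| ^ 3 * v := by
    have : (u ^ 2 * v) * (u ^ 2 * v) ≤ (u ^ 2 * v) * (|u| * C) :=
      mul_le_mul_of_nonneg_left (hle1.trans hle2) hy0
    have e : (u ^ 2 * v) * (|u| * C) = C * |u| ^ 3 * v := by rw [← sq_abs u]; ring
    have h0 : 0 ≤ C * |u| ^ 3 * v := by positivity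
    rw [e] at this
    nlinarith
  have h4 : ‖((1 - u ^ 2 * v / 2 : ℝ) : ℂ) - (Real.exp (-(u ^ 2 * v / 2)) : ℝ)‖
      ≤ C * |u| ^ 3 * v := by
    rw [← Complex.ofReal_sub, Complex.norm_real, norm_sub_rev]
    refine le_trans (le_of_eq ?_) (h2.trans h3)
    congr 1; ring
  calc _ ≤ _ := norm_sub_le_norm_sub_add_norm_sub _ ((1 - u ^ 2 * v / 2 : ℝ) : ℂ) _
    _ ≤ C * |u| ^ 3 * v + C * |u| ^ 3 * v := add_le_add h1 h4
    _ = _ := by ring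

theorem norm_prod_sub_prod_le {ι : Type*} (s : Finset ι) (f g : ι → ℂ)
    (hf : ∀ i, ‖f i‖ ≤ 1) (hg : ∀ i, ‖g i‖ ≤ 1) :
    ‖∏ i ∈ s, f i - ∏ i ∈ s, g i‖ ≤ ∑ i ∈ s, ‖f i - g i‖ := by
  classical
  induction s using Finset.induction_on with
  | empty => simp
  | insert i s hi ih =>
    rw [Finset.prod_insert hi, Finset.prod_insert hi, Finset.sum_insert hi]
    have hp : ‖∏ j ∈ s, f j‖ ≤ 1 := by
      rw [norm_prod]; exact Finset.prod_le_one (fun _ _ => norm_nonneg _) fun j _ => hf j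
    have e : f i * ∏ j ∈ s, f j - g i * ∏ j ∈ s, g j
        = (f i - g i) * ∏ j ∈ s, f j + g i * (∏ j ∈ s, f j - ∏ j ∈ s, g j) := by ring
    rw [e]
    refine (norm_add_le _ _).trans ?_
    rw [norm_mul, norm_mul]
    exact add_le_add (mul_le_of_le_one_right (norm_nonneg _) hp)
      ((mul_le_of_le_one_left (norm_nonneg _) (hg i)).trans ih)

/-- Convergence of the characteristic functions of the standardized laws is enough, by Lévy's
theorem and because the normal law has no atoms. -/
theorem asymptoticallyNormal_of_charFun {μ : ℕ → Measure ℝ} [∀ n, IsProbabilityMeasure (μ n)]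
    (h : ∀ t : ℝ, Tendsto (fun n => charFun (standardize (μ n)) t) atTop
      (𝓝 (Complex.exp (-(t ^ 2 / 2))))) : AsymptoticallyNormal μ := by
  have hp : ∀ n, IsProbabilityMeasure (standardize (μ n)) := fun n =>
    Measure.isProbabilityMeasure_map (by fun_prop)
  let ρ : ℕ → ProbabilityMeasure ℝ := fun n => ⟨standardize (μ n), hp n⟩
  let ρ₀ : ProbabilityMeasure ℝ := ⟨gaussianReal 0 1, inferInstance⟩
  have hlim : Tendsto ρ atTop (𝓝 ρ₀) := by
    rw [ProbabilityMeasure.tendsto_iff_tendsto_charFun]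
    intro t
    have : charFun (gaussianReal 0 1) t = Complex.exp (-(t ^ 2 / 2)) := by
      rw [charFun_gaussianReal]; simp
    change Tendsto (fun n => charFun (standardize (μ n)) t) atTop (𝓝 (charFun (gaussianReal 0 1) t))
    rw [this]
    exact h t
  intro x
  have := nullSingletonClass_gaussianReal (μ := 0) (v := 1) one_ne_zero
  have hx : (ρ₀ : Measure ℝ) (frontier (Set.Iic x)) = 0 := by
    rw [frontier_Iic]
    exact measure_singleton (μ := gaussianReal 0 1) x
  have := ProbabilityMeasure.tendsto_measure_of_null_frontier_of_tendsto' hlim hx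
  exact (ENNReal.tendsto_toReal (measure_ne_top (gaussianReal 0 1) _)).comp this

/-- Iterated convolutions of laws carried by intervals of a fixed length are asymptotically normal
as soon as the sum of the variances diverges. -/
theorem asymptoticallyNormal_of_conv {μ ν : ℕ → Measure ℝ} [∀ n, IsProbabilityMeasure (ν n)]
    {C : ℝ} (hC : 0 ≤ C) (hν : ∀ n, ∃ a, ∀ᵐ x ∂ν n, x ∈ Set.Icc a (a + C))
    (h0 : μ 0 = ν 0) (hs : ∀ n, μ (n + 1) = μ n ∗ ν (n + 1))
    (hvar : Tendsto (fun n => ∑ k ∈ Finset.range (n + 1), variance id (ν k)) atTop atTop) :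
    AsymptoticallyNormal μ := by
  have hLν : ∀ n, MemLp id 2 (ν n) := fun n => memLp_id_of_ae_mem_Icc (hν n).choose_spec
  have hμ : ∀ n, IsProbabilityMeasure (μ n) ∧ MemLp id 2 (μ n) ∧
      variance id (μ n) = ∑ k ∈ Finset.range (n + 1), variance id (ν k) ∧
      ∀ u, centeredCharFun (μ n) u = ∏ k ∈ Finset.range (n + 1), centeredCharFun (ν k) u := by
    intro n
    induction n with
    | zero => rw [h0]; exact ⟨inferInstance, hLν 0, by simp, by simp⟩
    | succ n ih =>
      obtain ⟨i1, i2, i3, i4⟩ := ih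
      rw [hs n]
      refine ⟨inferInstance, memLp_id_conv i2 (hLν _), ?_, fun u => ?_⟩
      · rw [variance_id_conv i2 (hLν _), i3, Finset.sum_range_succ _ (n + 1)]
      · rw [centeredCharFun_conv i2 (hLν _), i4, Finset.prod_range_succ _ (n + 1)]
  have hμp : ∀ n, IsProbabilityMeasure (μ n) := fun n => (hμ n).1
  refine asymptoticallyNormal_of_charFun fun t => ?_
  set S : ℕ → ℝ := fun n => √(∑ k ∈ Finset.range (n + 1), variance id (ν k)) with hS
  have hSt : Tendsto S atTop atTop := Real.tendsto_sqrt_atTop.comp hvar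
  have hSi : Tendsto (fun n => (S n)⁻¹) atTop (𝓝 0) := tendsto_inv_atTop_zero.comp hSt
  have hsmall : ∀ᶠ n in atTop, |(S n)⁻¹ * t| * C ≤ 1 := by
    have : Tendsto (fun n => |(S n)⁻¹ * t| * C) atTop (𝓝 (|0 * t| * C)) :=
      ((hSi.mul_const t).abs).mul_const C
    rw [zero_mul, abs_zero, zero_mul] at this
    exact this.eventually_le_const one_pos
  have hlim : Tendsto (fun n => 2 * C * |t| ^ 3 * (S n)⁻¹) atTop (𝓝 0) := by
    simpa using hSi.const_mul (2 * C * |t| ^ 3)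
  rw [tendsto_iff_norm_sub_tendsto_zero]
  refine squeeze_zero' (Eventually.of_forall fun _ => norm_nonneg _) ?_ hlim
  filter_upwards [hsmall, hSt.eventually_gt_atTop 0] with n hn hpos
  obtain ⟨-, -, i3, i4⟩ := hμ n
  set u := (S n)⁻¹ * t with hu
  have hsq : S n ^ 2 = ∑ k ∈ Finset.range (n + 1), variance id (ν k) :=
    Real.sq_sqrt (Finset.sum_nonneg fun k _ => variance_nonneg _ _)
  have e1 : charFun (standardize (μ n)) t
      = ∏ k ∈ Finset.range (n + 1), centeredCharFun (ν k) u := by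
    rw [charFun_standardize, i3, i4]
  have e2 : Complex.exp (-(t ^ 2 / 2)) = ∏ k ∈ Finset.range (n + 1),
      ((Real.exp (-(u ^ 2 * variance id (ν k) / 2)) : ℝ) : ℂ) := by
    rw [← Complex.ofReal_prod, ← Real.exp_sum, Finset.sum_neg_distrib, ← Finset.sum_div,
      ← Finset.mul_sum, ← hsq, hu, mul_pow, inv_pow, mul_right_comm,
      inv_mul_cancel₀ (pow_ne_zero 2 hpos.ne'), one_mul]
    push_cast
    rfl
  rw [e1, e2]
  refine (norm_prod_sub_prod_le _ _ _ (fun k => ?_) fun k => ?_).trans ?_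
  · have : IsProbabilityMeasure ((ν k).map fun x => x - ∫ y, y ∂(ν k)) :=
      Measure.isProbabilityMeasure_map (by fun_prop)
    exact norm_charFun_le_one _
  · rw [Complex.norm_real, Real.norm_of_nonneg (Real.exp_nonneg _), Real.exp_le_one_iff,
      Left.neg_nonpos_iff]
    have := variance_nonneg id (ν k)
    positivity
  · calc _ ≤ ∑ k ∈ Finset.range (n + 1), 2 * C * |u| ^ 3 * variance id (ν k) :=
          Finset.sum_le_sum fun k _ =>
            norm_centeredCharFun_sub_exp_le hC (hν k).choose_spec hn
      _ = 2 * C * |u| ^ 3 * S n ^ 2 := by rw [← Finset.mul_sum, hsq]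
      _ = _ := by
        rw [hu, abs_mul, abs_of_pos (inv_pos.2 hpos)]
        field_simp

end CentralLimit

end GraphEmbedding

namespace GraphEmbedding

open Equiv

/-! ### Counting the cycles of a permutation -/

section Cycles

variable {X Y Z : Type*}

/-- The relation of lying on the same cycle is the smallest equivalence relation relating each
point to its image. -/
theorem rel_of_sameCycle {f : Perm X} (s : Setoid X) (h : ∀ x, s x (f x)) {x y : X}
    (hxy : f.SameCycle x y) : s x y := by
  obtain ⟨n, rfl⟩ := hxy
  induction n using Int.induction_on with
  | zero => exact s.refl x
  | succ n ih => rw [add_comm, zpow_add, zpow_one]; exact s.trans ih (h _)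
  | pred n ih =>
    refine s.trans ih (s.symm ?_)
    have := h ((f ^ (-(n : ℤ) - 1)) x)
    rwa [← Perm.mul_apply, ← zpow_one_add, add_sub_cancel] at this

theorem eq_of_sameCycle {f : Perm X} (q : X → Z) (h : ∀ x, q (f x) = q x) {x y : X}
    (hxy : f.SameCycle x y) : q x = q y :=
  rel_of_sameCycle (Setoid.ker q) (fun x => (h x).symm) hxy

theorem sameCycle_apply_self (f : Perm X) (x : X) : f.SameCycle x (f x) :=
  Perm.sameCycle_apply_right.2 (Perm.SameCycle.refl f x)

/-- The cycle of a permutation through a point. -/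
abbrev cycleAt (f : Perm X) (x : X) : Quotient (Perm.SameCycle.setoid f) := Quotient.mk _ x

theorem cycleAt_eq {f : Perm X} {x y : X} : cycleAt f x = cycleAt f y ↔ f.SameCycle x y :=
  Quotient.eq (r := Perm.SameCycle.setoid f)

theorem cycleAt_apply (f : Perm X) (x : X) : cycleAt f (f x) = cycleAt f x :=
  cycleAt_eq.2 (sameCycle_apply_self f x).symm

theorem sameCycle_of_semiconj {f : Perm X} {g : Perm Y} (e : X → Y) (h : ∀ x, e (f x) = g (e x))
    {x y : X} (hxy : f.SameCycle x y) : g.SameCycle (e x) (e y) :=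
  cycleAt_eq.1 <| eq_of_sameCycle (fun x => cycleAt g (e x))
    (fun x => by simp only [h, cycleAt_apply]) hxy

theorem sameCycle_congr {f : Perm X} {g : Perm Y} (e : X ≃ Y) (h : ∀ x, e (f x) = g (e x))
    {x y : X} : g.SameCycle (e x) (e y) ↔ f.SameCycle x y := by
  refine ⟨fun hxy => ?_, sameCycle_of_semiconj e h⟩
  simpa using sameCycle_of_semiconj e.symm (fun y => by
    rw [Equiv.symm_apply_eq, h, Equiv.apply_symm_apply]) hxy

theorem numCycles_congr {f : Perm X} {g : Perm Y} (e : X ≃ Y) (h : ∀ x, e (f x) = g (e x)) :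
    numCycles f = numCycles g :=
  Nat.card_congr (Quotient.congr e fun _ _ => (sameCycle_congr e h).symm)

/-- `g` is obtained from `f` by skipping the points `inr y`, none of which is followed by another
one: the cycles of `f` are those of `g` and the fixed points among the `inr y`. -/
theorem cycles_of_skip [Finite X] [Finite Y] {f : Perm (X ⊕ Y)} {g : Perm X}
    (h₁ : ∀ x, f (.inl x) = .inl (g x) ∨ ∃ y, f (.inl x) = .inr y ∧ f (.inr y) = .inl (g x))
    (h₂ : ∀ y, f (.inr y) = .inr y ∨ ∃ x, f (.inr y) = .inl x) :
    numCycles f = numCycles g + Nat.card {y // f (.inr y) = .inr y} ∧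
      ∀ x x', f.SameCycle (.inl x) (.inl x') ↔ g.SameCycle x x' := by
  classical
  have h₃ : ∀ y, ¬ f (.inr y) = .inr y → ∃ x, f (.inr y) = .inl x := fun y hy =>
    (h₂ y).resolve_left hy
  let ρ : X ⊕ Y → Quotient (Perm.SameCycle.setoid g) ⊕ {y // f (.inr y) = .inr y} :=
    Sum.elim (fun x => .inl (cycleAt g x)) fun y =>
      if h : f (.inr y) = .inr y then .inr ⟨y, h⟩ else .inl (cycleAt g (h₃ y h).choose)
  have ρ_inr : ∀ {y x}, f (.inr y) = .inl x → ρ (.inr y) = .inl (cycleAt g x) := by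
    intro y x hyx
    have hne : ¬ f (.inr y) = .inr y := by rw [hyx]; exact Sum.inl_ne_inr
    have hc := Sum.inl_injective (hyx.symm.trans (h₃ y hne).choose_spec)
    simp only [ρ, Sum.elim_inr, dif_neg hne]
    rw [← hc]
  have ρ_fix : ∀ {y} (h : f (.inr y) = .inr y), ρ (.inr y) = .inr ⟨y, h⟩ := by
    intro y h
    simp only [ρ, Sum.elim_inr, dif_pos h]
  have ρ_step : ∀ z, ρ (f z) = ρ z := by
    rintro (x | y)
    · rcases h₁ x with h | ⟨y, h, h'⟩
      · rw [h]; exact congrArg Sum.inl (cycleAt_apply g x)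
      · rw [h, ρ_inr h']; exact congrArg Sum.inl (cycleAt_apply g x)
    · rcases h₂ y with h | ⟨x, h⟩
      · rw [h]
      · rw [ρ_inr h, h]; rfl
  have up : ∀ {x x'}, g.SameCycle x x' → f.SameCycle (.inl x) (.inl x') := by
    intro x x' h
    refine cycleAt_eq.1 (eq_of_sameCycle (fun x => cycleAt f (.inl x)) (fun x => ?_) h)
    rcases h₁ x with h | ⟨y, h, h'⟩
    · rw [← h, cycleAt_apply]
    · rw [← h', cycleAt_apply, ← h, cycleAt_apply]
  refine ⟨?_, fun x x' => ⟨fun h => ?_, up⟩⟩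
  · rw [numCycles, numCycles, ← Nat.card_sum]
    refine Nat.card_congr
      { toFun := Quotient.lift ρ fun _ _ h => eq_of_sameCycle ρ ρ_step h
        invFun := Sum.elim (Quotient.lift (fun x => cycleAt f (.inl x)) fun _ _ h =>
          cycleAt_eq.2 (up h)) fun y => cycleAt f (.inr y)
        left_inv := ?_
        right_inv := ?_ }
    · refine Quotient.ind ?_
      rintro (x | y)
      · rfl
      · rcases h₂ y with h | ⟨x, h⟩
        · change Sum.elim _ _ (ρ (.inr y)) = cycleAt f (.inr y)
          rw [ρ_fix h]; rfl
        · change Sum.elim _ _ (ρ (.inr y)) = cycleAt f (.inr y)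
          rw [ρ_inr h]; exact (congrArg (cycleAt f) h.symm).trans (cycleAt_apply _ _)
    · rintro (c | ⟨y, h⟩)
      · induction c using Quotient.ind; rfl
      · exact ρ_fix h
  · exact cycleAt_eq.1 (Sum.inl_injective (eq_of_sameCycle ρ ρ_step h))

theorem sameCycle_sumCongr_inl (f : Perm X) (g : Perm Y) {x x' : X} :
    (f.sumCongr g).SameCycle (.inl x) (.inl x') ↔ f.SameCycle x x' := by
  refine ⟨fun h => ?_, sameCycle_of_semiconj Sum.inl fun _ => rfl⟩
  have := eq_of_sameCycle (Z := Quotient (Perm.SameCycle.setoid f) ⊕ Unit)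
    (Sum.map (cycleAt f) fun _ => ()) (by rintro (x | y) <;> simp [cycleAt_apply]) h
  exact cycleAt_eq.1 (Sum.inl_injective this)

theorem sameCycle_sumCongr_inr (f : Perm X) (g : Perm Y) {y y' : Y} :
    (f.sumCongr g).SameCycle (.inr y) (.inr y') ↔ g.SameCycle y y' := by
  refine ⟨fun h => ?_, sameCycle_of_semiconj Sum.inr fun _ => rfl⟩
  have := eq_of_sameCycle (Z := Unit ⊕ Quotient (Perm.SameCycle.setoid g))
    (Sum.map (fun _ => ()) (cycleAt g)) (by rintro (x | y) <;> simp [cycleAt_apply]) h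
  exact cycleAt_eq.1 (Sum.inr_injective this)

theorem not_sameCycle_sumCongr (f : Perm X) (g : Perm Y) {x : X} {y : Y} :
    ¬ (f.sumCongr g).SameCycle (.inl x) (.inr y) := fun h => by
  have := eq_of_sameCycle Sum.isLeft (by rintro (x | y) <;> simp) h
  simp at this

theorem numCycles_sumCongr [Finite X] [Finite Y] (f : Perm X) (g : Perm Y) :
    numCycles (f.sumCongr g) = numCycles f + numCycles g := by
  rw [numCycles, numCycles, numCycles, ← Nat.card_sum]
  refine Nat.card_congr
    { toFun := Quotient.lift (Sum.map (cycleAt f) (cycleAt g)) fun _ _ h =>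
        eq_of_sameCycle _ (by rintro (x | y) <;> simp [cycleAt_apply]) h
      invFun := Sum.elim
        (Quotient.lift (fun x => cycleAt (f.sumCongr g) (.inl x)) fun _ _ h =>
          cycleAt_eq.2 ((sameCycle_sumCongr_inl f g).2 h))
        (Quotient.lift (fun y => cycleAt (f.sumCongr g) (.inr y)) fun _ _ h =>
          cycleAt_eq.2 ((sameCycle_sumCongr_inr f g).2 h))
      left_inv := ?_
      right_inv := ?_ }
  · refine Quotient.ind ?_
    rintro (x | y) <;> rfl
  · rintro (c | c) <;> induction c using Quotient.ind <;> rfl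

/-- Composing with the transposition of two points of different cycles merges these cycles. -/
theorem cycles_mul_swap [Finite X] [DecidableEq X] {f : Perm X} {x y : X}
    (hxy : ¬ f.SameCycle x y) :
    numCycles (f * swap x y) + 1 = numCycles f ∧
      ∀ {z w}, (f * swap x y).SameCycle z w → ¬ f.SameCycle z w →
        (f.SameCycle z x ∨ f.SameCycle z y) ∧ (f.SameCycle w x ∨ f.SameCycle w y) := by
  classical
  set f' := f * swap x y with hf'
  have hne : x ≠ y := fun h => hxy (h ▸ Perm.SameCycle.refl f x)
  have f'x : f' x = f y := by simp [f']
  have f'y : f' y = f x := by simp [f']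
  have f'z : ∀ {z}, z ≠ x → z ≠ y → f' z = f z := fun h h' => by
    simp [f', swap_apply_of_ne_of_ne h h']
  -- going from `y` along `f'` one runs through the `f`-cycle of `x` until one reaches `x`
  have hyx : f'.SameCycle y x := by
    have aux : ∀ n : ℕ, (∃ m ≤ n, (f ^ m) (f x) = x ∧ f'.SameCycle y x) ∨
        f'.SameCycle y ((f ^ n) (f x)) := by
      intro n
      induction n with
      | zero => right; rw [pow_zero, Perm.one_apply, ← f'y]; exact sameCycle_apply_self _ _
      | succ n ih =>
        rcases ih with ⟨m, hm, h⟩ | ih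
        · exact Or.inl ⟨m, by omega, h⟩
        by_cases hx : (f ^ n) (f x) = x
        · exact Or.inl ⟨n, by omega, hx, by rwa [hx] at ih⟩
        · right
          have hy : (f ^ n) (f x) ≠ y := fun h => hxy ⟨n + 1, by
            rw [← h, ← Perm.mul_apply, ← pow_succ]; norm_cast⟩
          rw [pow_succ', Perm.mul_apply, ← f'z hx hy]
          exact Perm.sameCycle_apply_right.2 ih
    obtain ⟨n, hn⟩ := (sameCycle_apply_self f x).symm.exists_nat_pow_eq
    rcases aux n with ⟨_, _, _, h⟩ | h
    · exact h
    · rwa [hn] at h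
  have up : ∀ {z w}, f.SameCycle z w → f'.SameCycle z w := by
    intro z w h
    refine cycleAt_eq.1 (eq_of_sameCycle (cycleAt f') (fun z => ?_) h)
    by_cases hx : z = x
    · rw [hx, ← f'y, cycleAt_apply]; exact cycleAt_eq.2 hyx
    by_cases hy : z = y
    · rw [hy, ← f'x, cycleAt_apply]; exact cycleAt_eq.2 hyx.symm
    · rw [← f'z hx hy, cycleAt_apply]
  let m : X → Quotient (Perm.SameCycle.setoid f) := fun z =>
    if cycleAt f z = cycleAt f x then cycleAt f y else cycleAt f z
  have hyx' : cycleAt f y ≠ cycleAt f x := fun h => hxy (cycleAt_eq.1 h).symm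
  have mx : m x = cycleAt f y := if_pos rfl
  have my : m y = cycleAt f y := if_neg hyx'
  have mf : ∀ z, m (f z) = m z := fun z => by simp only [m, cycleAt_apply]
  have m_step : ∀ z, m (f' z) = m z := by
    intro z
    by_cases hx : z = x
    · rw [hx, f'x, mf, my, mx]
    by_cases hy : z = y
    · rw [hy, f'y, mf, my, mx]
    · rw [f'z hx hy, mf]
  have m_ne : ∀ z, m z ≠ cycleAt f x := by
    intro z
    by_cases h : cycleAt f z = cycleAt f x
    · simpa only [m, if_pos h] using hyx'
    · simpa only [m, if_neg h] using h
  constructor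
  · have e : Quotient (Perm.SameCycle.setoid f') ≃ {c // c ≠ cycleAt f x} :=
      { toFun := Quotient.lift (fun z => ⟨m z, m_ne z⟩) fun _ _ h =>
          Subtype.ext (eq_of_sameCycle m m_step h)
        invFun := fun c => Quotient.lift (cycleAt f') (fun _ _ h => cycleAt_eq.2 (up h)) c.1
        left_inv := by
          refine Quotient.ind fun z => ?_
          change Quotient.lift _ _ (m z) = _
          by_cases h : cycleAt f z = cycleAt f x
          · simp only [m, if_pos h]
            exact cycleAt_eq.2 (hyx.trans (up (cycleAt_eq.1 h).symm))
          · simp only [m, if_neg h]; rfl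
        right_inv := by
          rintro ⟨c, hc⟩
          induction c using Quotient.ind
          exact Subtype.ext (if_neg hc) }
    have := Fintype.ofFinite (Quotient (Perm.SameCycle.setoid f))
    rw [numCycles, Nat.card_congr e, numCycles, Nat.card_eq_fintype_card,
      Nat.card_eq_fintype_card, Fintype.card_subtype_compl, Fintype.card_subtype_eq]
    have : 0 < Fintype.card (Quotient (Perm.SameCycle.setoid f)) :=
      Fintype.card_pos_iff.2 ⟨cycleAt f x⟩
    omega
  · intro z w h hzw
    have hm := eq_of_sameCycle m m_step h
    by_cases hz : cycleAt f z = cycleAt f x <;> by_cases hw : cycleAt f w = cycleAt f x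
    · exact absurd (cycleAt_eq.1 (hz.trans hw.symm)) hzw
    · simp only [m, if_pos hz, if_neg hw] at hm
      exact ⟨Or.inl (cycleAt_eq.1 hz), Or.inr (cycleAt_eq.1 hm.symm)⟩
    · simp only [m, if_neg hz, if_pos hw] at hm
      exact ⟨Or.inr (cycleAt_eq.1 hm), Or.inl (cycleAt_eq.1 hw)⟩
    · simp only [m, if_neg hz, if_neg hw] at hm
      exact absurd (cycleAt_eq.1 hm) hzw

theorem numCycles_le_card [Finite X] (f : Perm X) : numCycles f ≤ Nat.card X :=
  Nat.card_le_card_of_surjective _ Quotient.mk_surjective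

end Cycles

/-! ### Permutations of signed darts -/

section Signed

variable {D : Type*}

/-- The permutation of the signed points induced by `σ`: it acts as `σ` on the positive sheet
and as `σ⁻¹` on the negative one. -/
def doubled (σ : Perm D) : Perm (D × Bool) where
  toFun x := (if x.2 then σ.symm x.1 else σ x.1, x.2)
  invFun x := (if x.2 then σ x.1 else σ.symm x.1, x.2)
  left_inv := by rintro ⟨d, _ | _⟩ <;> simp
  right_inv := by rintro ⟨d, _ | _⟩ <;> simp

/-- The permutation of the signed points induced by `τ`, which changes the sign where `w` is
`true`. -/
def twisted (τ : Perm D) (w : D → Bool) : Perm (D × Bool) where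
  toFun x := (τ x.1, xor x.2 (w x.1))
  invFun x := (τ.symm x.1, xor x.2 (w (τ.symm x.1)))
  left_inv := by rintro ⟨d, s⟩; simp
  right_inv := by rintro ⟨d, s⟩; simp

@[simp] theorem doubled_apply_false (σ : Perm D) (d : D) :
    doubled σ (d, false) = (σ d, false) := rfl

@[simp] theorem doubled_apply_true (σ : Perm D) (d : D) :
    doubled σ (d, true) = (σ.symm d, true) := rfl

@[simp] theorem twisted_apply (τ : Perm D) (w : D → Bool) (d : D) (s : Bool) :
    twisted τ w (d, s) = (τ d, xor s (w d)) := rfl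

/-- A face boundary and its reversal are different cycles. The reversal `θ` conjugates the face
permutation `P` to `P⁻¹`, so that `P ^ (n + 2) x = θ x` gives `P ^ n (P x) = θ (P x)`; this
descends to `n = 0`, where `θ` has no fixed points, or to `n = 1`, where the signs differ. -/
theorem not_sameCycle_reverse [Finite D] (σ τ : Perm D) (w : D → Bool)
    (hτ : ∀ d, τ (τ d) = d) (hw : ∀ d, w (τ d) = w d) (hfix : ∀ d, τ d = d → w d = false)
    (d : D) (s : Bool) :
    ¬ (doubled σ * twisted τ w).SameCycle (d, s) (τ d, !(xor s (w d))) := by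
  set P := doubled σ * twisted τ w with hP
  let θ : D × Bool → D × Bool := fun x => (τ x.1, !(xor x.2 (w x.1)))
  have hθ : ∀ x, P (θ (P x)) = θ x := by
    rintro ⟨d, s⟩
    simp only [hP, θ, Perm.mul_apply, twisted_apply]
    cases h : xor s (w d) <;> simp [hτ, hw]
  have key : ∀ n : ℕ, ∀ x, (P ^ n) x ≠ θ x := by
    intro n
    induction n using Nat.twoStepInduction with
    | zero =>
      rintro ⟨d, s⟩ h
      simp only [pow_zero, Perm.one_apply, θ, Prod.mk.injEq] at h
      have h' := h.2
      rw [hfix d h.1.symm] at h'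
      simp at h'
    | one =>
      rintro ⟨d, s⟩ h
      have h' := congrArg Prod.snd h
      simp only [pow_one, hP, θ, Perm.mul_apply, twisted_apply] at h'
      cases h : xor s (w d) <;> simp [h] at h'
    | more n ih _ =>
      intro x h
      rw [← hθ x, pow_succ', Perm.mul_apply, P.injective.eq_iff, pow_succ, Perm.mul_apply] at h
      exact ih _ h
  intro h
  obtain ⟨n, hn⟩ := h.exists_nat_pow_eq
  exact key n (d, s) hn

end Signed

end GraphEmbedding

namespace GraphEmbedding

open Equiv

/-! ### Adding a dart, and disjoint unions -/

section Rotations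

variable {X Y X' : Type*} {D D' D₁ D₂ V V' V₁ V₂ : Type*}

theorem cycles_of_skip_equiv [Finite X] [Finite Y] (E : X' ≃ X ⊕ Y) {f : Perm X'} {g : Perm X}
    (h₁ : ∀ x, f (E.symm (.inl x)) = E.symm (.inl (g x)) ∨
      ∃ y, f (E.symm (.inl x)) = E.symm (.inr y) ∧ f (E.symm (.inr y)) = E.symm (.inl (g x)))
    (h₂ : ∀ y, f (E.symm (.inr y)) = E.symm (.inr y) ∨
      ∃ x, f (E.symm (.inr y)) = E.symm (.inl x)) :
    numCycles f = numCycles g + Nat.card {y // f (E.symm (.inr y)) = E.symm (.inr y)} ∧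
      ∀ x x', f.SameCycle (E.symm (.inl x)) (E.symm (.inl x')) ↔ g.SameCycle x x' := by
  have hf : ∀ z, E.symm (E.permCongr f z) = f (E.symm z) := fun z => by simp
  have key := cycles_of_skip (f := E.permCongr f) (g := g)
    (by simpa only [← E.symm.injective.eq_iff, hf] using h₁)
    (by simpa only [← E.symm.injective.eq_iff, hf] using h₂)
  simp only [← E.symm.injective.eq_iff (b := Sum.inr _), hf] at key
  refine ⟨by rw [← key.1]; exact (numCycles_congr E.symm hf).symm, fun x x' => ?_⟩
  rw [← key.2]
  exact sameCycle_congr E.symm hf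

/-- The permutation obtained by skipping `none`: a point is sent to its image, or to the image
of `none` if its image is `none`. -/
abbrev skipNone (e : Perm (Option D)) : Perm D := removeNone e

theorem skipNone_cases (e : Perm (Option D)) (d : D) :
    e (some d) = some (skipNone e d) ∨ (e (some d) = none ∧ e none = some (skipNone e d)) := by
  rcases h : e (some d) with _ | d'
  · exact Or.inr ⟨rfl, (removeNone_none e h).symm⟩
  · exact Or.inl (by rw [removeNone_some e ⟨d', h⟩, h])

/-- Skipping the new dart in the face permutation gives the face permutation without it; a cycle is
lost only if the new dart is alone at its vertex. -/
theorem cycles_mul_optionCongr [Finite D] (e : Perm (Option D)) (τ : Perm D) :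
    numCycles (e * optionCongr τ) = numCycles (skipNone e * τ) +
        Nat.card {_y : Unit // e none = none} ∧
      ∀ d d', (e * optionCongr τ).SameCycle (some d) (some d') ↔
        (skipNone e * τ).SameCycle d d' := by
  refine cycles_of_skip_equiv (optionEquivSumPUnit D) (f := e * optionCongr τ)
    (g := skipNone e * τ) (fun d => ?_) fun y => ?_
  · rcases skipNone_cases e (τ d) with h | h
    · exact Or.inl h
    · exact Or.inr ⟨(), h⟩
  · change e none = none ∨ ∃ d, e none = some d
    cases e none <;> simp

theorem sameCycle_some_some [Finite D] (e : Perm (Option D)) {d d' : D} :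
    e.SameCycle (some d) (some d') ↔ (skipNone e).SameCycle d d' := by
  have := (cycles_mul_optionCongr e 1).2 d d'
  have h : optionCongr (1 : Perm D) = 1 := optionCongr_refl
  rwa [h, mul_one, mul_one] at this

/-- The signed version of `cycles_mul_optionCongr`: the new dart `none` occurs with both signs. -/
theorem numCycles_doubled_mul_twisted_option [Finite D] (e : Perm (Option D)) (τ : Perm D)
    (w : D → Bool) :
    numCycles (doubled e * twisted (optionCongr τ) fun o => o.elim false w) =
      numCycles (doubled (skipNone e) * twisted τ w) +
        2 * Nat.card {_y : Unit // e none = none} := by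
  let E : Option D × Bool ≃ D × Bool ⊕ Bool :=
    { toFun := fun x => x.1.elim (.inr x.2) fun d => .inl (d, x.2)
      invFun := Sum.elim (fun x => (some x.1, x.2)) fun s => (none, s)
      left_inv := by rintro ⟨_ | d, s⟩ <;> rfl
      right_inv := by rintro (x | s) <;> rfl }
  have hn : e.symm none = none ↔ e none = none := by rw [Equiv.symm_apply_eq, eq_comm]
  have key := (cycles_of_skip_equiv E
    (f := doubled e * twisted (optionCongr τ) fun o => o.elim false w)
    (g := doubled (skipNone e) * twisted τ w) ?_ ?_).1
  · rw [key]
    have : Nat.card {s : Bool // (doubled e * twisted (optionCongr τ) fun o => o.elim false w)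
        (E.symm (.inr s)) = E.symm (.inr s)} =
        Nat.card (Bool × {_y : Unit // e none = none}) := by
      refine Nat.card_congr ⟨fun s => (s.1, ⟨(), ?_⟩), fun s => ⟨s.1, ?_⟩, ?_, ?_⟩
      · rcases s with ⟨s, hs⟩
        replace hs : doubled e (none, xor s false) = (none, s) := hs
        cases s
        · exact congrArg Prod.fst hs
        · exact hn.1 (congrArg Prod.fst hs)
      · obtain ⟨s, -, h⟩ := s
        change doubled e (none, xor s false) = (none, s)
        cases s
        · exact Prod.ext h rfl
        · exact Prod.ext (hn.2 h) rfl
      · intro s; rfl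
      · intro s; rfl
    rw [this, Nat.card_prod, Nat.card_eq_fintype_card, Fintype.card_bool]
  · rintro ⟨d, s⟩
    change doubled e (some (τ d), xor s (w d)) = (some _, _) ∨ ∃ t,
      doubled e (some (τ d), xor s (w d)) = (none, t) ∧
      doubled e (none, xor t false) = (some _, _)
    simp only [Perm.mul_apply, twisted_apply]
    cases xor s (w d)
    · rcases skipNone_cases e (τ d) with h | h
      · exact Or.inl (Prod.ext h rfl)
      · exact Or.inr ⟨false, Prod.ext h.1 rfl, Prod.ext h.2 rfl⟩
    · rcases skipNone_cases e.symm (τ d) with h | h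
      · exact Or.inl (Prod.ext h rfl)
      · exact Or.inr ⟨true, Prod.ext h.1 rfl, Prod.ext h.2 rfl⟩
  · intro s
    change doubled e (none, xor s false) = (none, s) ∨ ∃ x : D × Bool,
      doubled e (none, xor s false) = (some x.1, x.2)
    cases s
    · rcases h : e none with _ | d
      · exact Or.inl (Prod.ext h rfl)
      · exact Or.inr ⟨(d, false), Prod.ext h rfl⟩
    · rcases h : e.symm none with _ | d
      · exact Or.inl (Prod.ext h rfl)
      · exact Or.inr ⟨(d, true), Prod.ext h rfl⟩

/-- A rotation for an assignment `p` of darts to vertices: a permutation whose cycles are the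
sets of darts at the vertices carrying darts. -/
def Rotation (p : D → V) : Type _ :=
  {σ : Perm D // ∀ d d', σ.SameCycle d d' ↔ p d = p d'}

instance [Finite D] (p : D → V) : Finite (Rotation p) := Subtype.finite

/-- The assignment of darts to vertices after adding a dart `none` at the vertex `u`. -/
def addDart (p : D → V) (u : V) (o : Option D) : V := o.elim u p

/-- The dart following the new dart `none` in a rotation around `u`: any dart at `u`, or `none`
itself if there is no other dart at `u`. -/
def IsSlot (p : D → V) (u : V) : Option D → Prop
  | none => ∀ d, p d ≠ u
  | some d => p d = u

theorem exists_isSlot (p : D → V) (u : V) : ∃ o, IsSlot p u o := by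
  by_cases h : ∃ d, p d = u
  · exact ⟨some h.choose, h.choose_spec⟩
  · exact ⟨none, fun d hd => h ⟨d, hd⟩⟩

theorem rotation_addDart_iff [Finite D] {p : D → V} {u : V} (e : Perm (Option D)) :
    (∀ d d', e.SameCycle d d' ↔ addDart p u d = addDart p u d') ↔
      IsSlot p u (e none) ∧ ∀ d d', (skipNone e).SameCycle d d' ↔ p d = p d' := by
  constructor
  · intro h
    refine ⟨?_, fun d d' => by rw [← sameCycle_some_some, h]; rfl⟩
    rcases he : e none with _ | d
    · intro d hd
      have : e.SameCycle none (some d) := (h _ _).2 hd.symm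
      obtain ⟨n, hn⟩ := this
      rw [Perm.zpow_apply_eq_self_of_apply_eq_self he] at hn
      cases hn
    · have := (h _ _).1 (sameCycle_apply_self e none)
      rw [he] at this
      exact this.symm
  · rintro ⟨h, hs⟩
    have key : ∀ d, e.SameCycle none (some d) ↔ u = p d := by
      intro d
      rcases he : e none with _ | d₀
      · rw [he] at h
        refine ⟨fun ⟨n, hn⟩ => ?_, fun hd => absurd hd.symm (h d)⟩
        rw [Perm.zpow_apply_eq_self_of_apply_eq_self he] at hn
        cases hn
      · rw [he] at h
        rw [← Perm.sameCycle_apply_left, he, sameCycle_some_some, hs, h]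
    rintro (_ | d) (_ | d')
    · exact ⟨fun _ => rfl, fun _ => Perm.SameCycle.refl _ _⟩
    · exact key d'
    · rw [Perm.sameCycle_comm, key]; exact eq_comm
    · rw [sameCycle_some_some, hs]; rfl

/-- A rotation with a dart added at `u` is a rotation without this dart together with the place
where it is inserted. -/
noncomputable def rotationAddDart [Finite D] (p : D → V) (u : V) :
    Rotation (addDart p u) ≃ {o // IsSlot p u o} × Rotation p := by
  classical
  exact (Perm.decomposeOption.subtypeEquiv fun e => rotation_addDart_iff e).trans
    (subtypeProdEquivProd (p := IsSlot p u)
      (q := fun σ : Perm D => ∀ d d', σ.SameCycle d d' ↔ p d = p d'))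

theorem rotation_sumCongr {p : D₁ → V₁} {q : D₂ → V₂} (R : Rotation p) (S : Rotation q)
    (d d' : D₁ ⊕ D₂) :
    (R.1.sumCongr S.1).SameCycle d d' ↔ Sum.map p q d = Sum.map p q d' := by
  rcases d with d | d <;> rcases d' with d' | d'
  · rw [sameCycle_sumCongr_inl, R.2]; simp
  · simp [not_sameCycle_sumCongr]
  · rw [Perm.sameCycle_comm]; simp [not_sameCycle_sumCongr]
  · rw [sameCycle_sumCongr_inr, S.2]; simp

/-- A rotation on a disjoint union is a pair of rotations. -/
noncomputable def rotationSum [Finite D₁] [Finite D₂] (p : D₁ → V₁) (q : D₂ → V₂) :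
    Rotation p × Rotation q ≃ Rotation (Sum.map p q) :=
  Equiv.ofBijective (fun R => ⟨R.1.1.sumCongr R.2.1, rotation_sumCongr R.1 R.2⟩) <| by
    constructor
    · rintro ⟨⟨σ, hσ⟩, ⟨σ', hσ'⟩⟩ ⟨⟨ρ, hρ⟩, ⟨ρ', hρ'⟩⟩ h
      have h' : Perm.sumCongr σ σ' = Perm.sumCongr ρ ρ' := congrArg Subtype.val h
      have := Perm.sumCongrHom_injective (a₁ := (σ, σ')) (a₂ := (ρ, ρ')) h'
      simp only [Prod.mk.injEq] at this
      obtain ⟨rfl, rfl⟩ := this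
      rfl
    · rintro ⟨σ, hσ⟩
      have hmaps : Set.MapsTo σ (Set.range Sum.inl) (Set.range Sum.inl) := by
        rintro _ ⟨d, rfl⟩
        have := (hσ _ _).1 (sameCycle_apply_self σ (.inl d))
        rcases h : σ (.inl d) with d' | d'
        · exact ⟨d', rfl⟩
        · rw [h] at this; simp at this
      obtain ⟨⟨σ₁, σ₂⟩, rfl⟩ := Perm.mem_sumCongrHom_range_of_perm_mapsTo_inl hmaps
      refine ⟨(⟨σ₁, fun d d' => ?_⟩, ⟨σ₂, fun d d' => ?_⟩), rfl⟩
      · rw [← sameCycle_sumCongr_inl σ₁ σ₂]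
        refine (hσ _ _).trans ?_
        simp
      · rw [← sameCycle_sumCongr_inr σ₁ σ₂]
        refine (hσ _ _).trans ?_
        simp

/-- Transport of rotations along a bijection of darts. -/
def rotationCongr {p : D → V} {p' : D' → V'} (ψ : D ≃ D') (ν : V → V')
    (hν : Function.Injective ν) (h : ∀ d, p' (ψ d) = ν (p d)) : Rotation p ≃ Rotation p' :=
  ψ.permCongr.subtypeEquiv fun σ => by
    rw [← ψ.forall_congr_right (q := fun d => ∀ d', (ψ.permCongr σ).SameCycle d d' ↔ p' d = p' d')]
    refine forall_congr' fun d => ?_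
    rw [← ψ.forall_congr_right
      (q := fun d' => (ψ.permCongr σ).SameCycle (ψ d) d' ↔ p' (ψ d) = p' d')]
    refine forall_congr' fun d' => ?_
    rw [sameCycle_congr (f := σ) ψ (fun x => by simp), h, h, hν.eq_iff]

theorem rotationCongr_apply {p : D → V} {p' : D' → V'} (ψ : D ≃ D') (ν : V → V')
    (hν : Function.Injective ν) (h : ∀ d, p' (ψ d) = ν (p d)) (R : Rotation p) (d : D) :
    (rotationCongr ψ ν hν h R).1 (ψ d) = ψ (R.1 d) := by
  change ψ.permCongr R.1 (ψ d) = _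
  simp

instance nonempty_rotation [Finite D] (p : D → V) : Nonempty (Rotation p) := by
  revert p
  induction D using Finite.induction_empty_option with
  | of_equiv ψ ih =>
    intro p
    exact (ih (p ∘ ψ)).map (rotationCongr (p' := p) ψ id Function.injective_id fun _ => rfl)
  | h_empty => exact fun p => ⟨⟨1, fun d => d.elim⟩⟩
  | h_option ih =>
    intro p
    obtain ⟨o, ho⟩ := exists_isSlot (p ∘ some) (p none)
    have e : addDart (p ∘ some) (p none) = p := by
      funext o; cases o <;> rfl
    rw [← e]
    exact (ih (p ∘ some)).map fun R => (rotationAddDart _ _).symm (⟨o, ho⟩, R)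

end Rotations

/-! ### The number of faces of a bar-amalgamation -/

section Faces

variable {D D₁ D₂ V V₁ V₂ : Type*}

/-- The number of vertices without darts. -/
noncomputable def isolatedCount (p : D → V) : ℕ := Nat.card {v : V // ∀ d, p d ≠ v}

/-- A dart added at a vertex without darts makes up for the additional cycle counted in
`cycles_mul_optionCongr`. -/
theorem isolatedCount_addDart [Finite V] {p : D → V} {u : V} {o : Option D} (ho : IsSlot p u o) :
    isolatedCount (addDart p u) + Nat.card {_y : Unit // o = none} = isolatedCount p := by
  classical
  rcases o with _ | d
  · have := Fintype.ofFinite V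
    have e1 : Nat.card {_y : Unit // (none : Option D) = none} = 1 := by simp
    let a : {v : V // ∀ d, p d ≠ v} := ⟨u, ho⟩
    have e2 : {v : V // ∀ o, addDart p u o ≠ v} ≃ {b : {v : V // ∀ d, p d ≠ v} // b ≠ a} :=
      { toFun := fun v => ⟨⟨v.1, fun d => v.2 (some d)⟩, fun h =>
          v.2 none (congrArg Subtype.val h).symm⟩
        invFun := fun v => ⟨v.1.1, fun o => by
          rcases o with _ | d
          · exact fun h => v.2 (Subtype.ext h.symm)
          · exact v.1.2 d⟩
        left_inv := fun _ => rfl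
        right_inv := fun _ => rfl }
    rw [e1, isolatedCount, isolatedCount, Nat.card_congr e2, Nat.card_eq_fintype_card,
      Nat.card_eq_fintype_card, Fintype.card_subtype_compl, Fintype.card_subtype_eq]
    exact Nat.sub_add_cancel (Fintype.card_pos_iff.2 ⟨a⟩)
  · have e1 : Nat.card {_y : Unit // some d = none} = 0 := by simp
    rw [e1, add_zero]
    refine Nat.card_congr (subtypeEquivRight fun v => ⟨fun h d => h (some d), fun h o => ?_⟩)
    rcases o with _ | d'
    · exact fun h' => h d (Eq.trans ho h')
    · exact h d'

theorem isolatedCount_sum [Finite V₁] [Finite V₂] (p : D₁ → V₁) (q : D₂ → V₂) :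
    isolatedCount (Sum.map p q) = isolatedCount p + isolatedCount q := by
  rw [isolatedCount, isolatedCount, isolatedCount, ← Nat.card_sum]
  refine Nat.card_congr (subtypeSum.trans (Equiv.sumCongr ?_ ?_))
  · exact subtypeEquivRight fun v => by simp
  · exact subtypeEquivRight fun v => by simp

/-- The number of faces given by a rotation `σ`, where `τ` exchanges the darts of each edge. -/
noncomputable def faceCount (p : D → V) (τ σ : Perm D) : ℕ :=
  numCycles (σ * τ) + isolatedCount p

/-- The number of faces given by a rotation `σ`, where `τ` exchanges the darts of each edge
and `w` marks the darts of the twisted edges. -/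
noncomputable def signedFaceCount (p : D → V) (τ : Perm D) (w : D → Bool) (σ : Perm D) : ℝ :=
  (numCycles (doubled σ * twisted τ w) : ℝ) / 2 + isolatedCount p

/-- The darts of a bar-amalgamation: those of the two parts, and one dart `none` of the new edge
on either side. -/
abbrev BarDart (D₁ D₂ : Type*) : Type _ := Option D₁ ⊕ Option D₂

/-- The assignment of the darts of a bar-amalgamation to its vertices. -/
abbrev barVertex (p : D₁ → V₁) (q : D₂ → V₂) (u : V₁) (v : V₂) : BarDart D₁ D₂ → V₁ ⊕ V₂ :=
  Sum.map (addDart p u) (addDart q v)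

open Classical in
/-- The involution exchanging the two darts of each edge of a bar-amalgamation. -/
noncomputable def barFlip (τ₁ : Perm D₁) (τ₂ : Perm D₂) : Perm (BarDart D₁ D₂) :=
  (optionCongr τ₁).sumCongr (optionCongr τ₂) * swap (.inl none) (.inr none)

/-- The twists of a bar-amalgamation whose new edge has the twist `c`. -/
def barTwist (w₁ : D₁ → Bool) (w₂ : D₂ → Bool) (c : Bool) : BarDart D₁ D₂ → Bool :=
  Sum.elim (fun o => o.elim c w₁) fun o => o.elim c w₂

/-- A rotation of a bar-amalgamation consists of rotations of the two parts and of the places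
where the darts of the new edge are inserted. -/
noncomputable def rotationBar [Finite D₁] [Finite D₂] (p : D₁ → V₁) (q : D₂ → V₂) (u : V₁)
    (v : V₂) : Rotation (barVertex p q u v) ≃
      Rotation p × Rotation q × {o // IsSlot p u o} × {o // IsSlot q v o} :=
  (rotationSum (addDart p u) (addDart q v)).symm.trans <|
    ((rotationAddDart p u).prodCongr (rotationAddDart q v)).trans
      { toFun := fun x => (x.1.2, x.2.2, x.1.1, x.2.1)
        invFun := fun x => ((x.2.2.1, x.1), (x.2.2.2, x.2.1))
        left_inv := fun _ => rfl
        right_inv := fun _ => rfl }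

theorem rotationBar_spec [Finite D₁] [Finite D₂] (p : D₁ → V₁) (q : D₂ → V₂) (u : V₁) (v : V₂)
    (R : Rotation (barVertex p q u v)) :
    ∃ (e₁ : Perm (Option D₁)) (e₂ : Perm (Option D₂)), R.1 = e₁.sumCongr e₂ ∧
      IsSlot p u (e₁ none) ∧ IsSlot q v (e₂ none) ∧
      (rotationBar p q u v R).1.1 = skipNone e₁ ∧
      (rotationBar p q u v R).2.1.1 = skipNone e₂ := by
  obtain ⟨⟨R₁, R₂⟩, rfl⟩ := (rotationSum (addDart p u) (addDart q v)).surjective R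
  refine ⟨R₁.1, R₂.1, rfl, ((rotation_addDart_iff _).1 R₁.2).1,
    ((rotation_addDart_iff _).1 R₂.2).1, ?_, ?_⟩
  · rw [rotationBar, Equiv.trans_apply, Equiv.symm_apply_apply]; rfl
  · rw [rotationBar, Equiv.trans_apply, Equiv.symm_apply_apply]; rfl

/-- The new edge of a bar-amalgamation joins a face of the first part to a face of the second. -/
theorem faceCount_bar [Finite D₁] [Finite D₂] [Finite V₁] [Finite V₂] {p : D₁ → V₁}
    {q : D₂ → V₂} {u : V₁} {v : V₂} (τ₁ : Perm D₁) (τ₂ : Perm D₂)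
    (R : Rotation (barVertex p q u v)) :
    faceCount (barVertex p q u v) (barFlip τ₁ τ₂) R.1 + 1 =
      faceCount p τ₁ (rotationBar p q u v R).1.1 +
        faceCount q τ₂ (rotationBar p q u v R).2.1.1 := by
  classical
  obtain ⟨e₁, e₂, hR, s₁, s₂, h₁, h₂⟩ := rotationBar_spec p q u v R
  rw [hR, h₁, h₂]
  have hP : e₁.sumCongr e₂ * barFlip τ₁ τ₂ =
      (e₁ * optionCongr τ₁).sumCongr (e₂ * optionCongr τ₂) *
        swap (.inl none) (.inr none) := by
    ext x
    simp only [barFlip, Perm.mul_apply]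
    generalize (swap (Sum.inl none) (Sum.inr none) : Perm (BarDart D₁ D₂)) x = y
    rcases y with y | y <;> rfl
  have hm := (cycles_mul_swap (not_sameCycle_sumCongr (e₁ * optionCongr τ₁)
    (e₂ * optionCongr τ₂) (x := none) (y := none))).1
  rw [numCycles_sumCongr, (cycles_mul_optionCongr e₁ τ₁).1,
    (cycles_mul_optionCongr e₂ τ₂).1] at hm
  have i₁ := isolatedCount_addDart s₁
  have i₂ := isolatedCount_addDart s₂
  have i := isolatedCount_sum (addDart p u) (addDart q v)
  rw [faceCount, faceCount, faceCount, hP, barVertex, i]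
  omega

/-- For signed rotations the new edge merges two pairs of cycles: each face is traversed by two
cycles, exchanged by the reversal, so that the second pair is not yet merged by the first. -/
theorem signedFaceCount_bar [Finite D₁] [Finite D₂] [Finite V₁] [Finite V₂] {p : D₁ → V₁}
    {q : D₂ → V₂} {u : V₁} {v : V₂} {τ₁ : Perm D₁} (τ₂ : Perm D₂) {w₁ : D₁ → Bool}
    (w₂ : D₂ → Bool) (c : Bool) (hτ : ∀ d, τ₁ (τ₁ d) = d) (hτ' : ∀ d, τ₁ d ≠ d)
    (hw : ∀ d, w₁ (τ₁ d) = w₁ d) (R : Rotation (barVertex p q u v)) :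
    signedFaceCount (barVertex p q u v) (barFlip τ₁ τ₂) (barTwist w₁ w₂ c) R.1 + 1 =
      signedFaceCount p τ₁ w₁ (rotationBar p q u v R).1.1 +
        signedFaceCount q τ₂ w₂ (rotationBar p q u v R).2.1.1 := by
  classical
  obtain ⟨e₁, e₂, hR, s₁, s₂, h₁, h₂⟩ := rotationBar_spec p q u v R
  rw [hR, h₁, h₂]
  set P₁ := doubled e₁ * twisted (optionCongr τ₁) fun o => o.elim false w₁ with hP₁
  set P₂ := doubled e₂ * twisted (optionCongr τ₂) fun o => o.elim false w₂ with hP₂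
  set Q := P₁.sumCongr P₂ with hQ
  have hP : numCycles (doubled (e₁.sumCongr e₂) *
        twisted (barFlip τ₁ τ₂) (barTwist w₁ w₂ c)) =
      numCycles (Q * swap (.inl (none, false)) (.inr (none, c)) *
        swap (.inl (none, true)) (.inr (none, !c))) := by
    refine numCycles_congr (Equiv.sumProdDistrib _ _ _) ?_
    have hd : ∀ (x : BarDart D₁ D₂) (s : Bool),
        Equiv.sumProdDistrib _ _ _ (doubled (e₁.sumCongr e₂) (x, s)) =
        (doubled e₁).sumCongr (doubled e₂) (Equiv.sumProdDistrib _ _ _ (x, s)) := by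
      rintro (x | x) (_ | _) <;> rfl
    have hQ' : Q = (doubled e₁).sumCongr (doubled e₂) *
        (twisted (optionCongr τ₁) fun o => o.elim false w₁).sumCongr
          (twisted (optionCongr τ₂) fun o => o.elim false w₂) := by
      ext x; rcases x with x | x <;> rfl
    rintro ⟨x, s⟩
    rw [Perm.mul_apply, twisted_apply, hd, hQ', mul_assoc, mul_assoc, Perm.mul_apply]
    congr 1
    rcases x with (_ | d) | (_ | d) <;> cases s <;> cases c <;>
      simp [barFlip, barTwist, swap_apply_def]
  have hxy : ¬ Q.SameCycle (.inl (none, false)) (.inr (none, c)) :=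
    not_sameCycle_sumCongr P₁ P₂
  obtain ⟨m₁, hs⟩ := cycles_mul_swap hxy
  have hrev : ¬ P₁.SameCycle (none, false) (none, true) := by
    have := not_sameCycle_reverse e₁ (optionCongr τ₁) (fun o => o.elim false w₁) ?_ ?_ ?_
      none false
    · simpa using this
    · rintro (_ | d) <;> simp [hτ]
    · rintro (_ | d) <;> simp [hw]
    · rintro (_ | d) <;> simp [hτ']
  -- if the new points were on one cycle after the first merging, the two signed copies of the new
  -- dart of the first part would have been on one cycle before it
  have hxy' : ¬ Perm.SameCycle (Q * swap (.inl (none, false)) (.inr (none, c)))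
      (.inl (none, true)) (.inr (none, !c)) := by
    intro h
    rcases (hs h (not_sameCycle_sumCongr _ _)).1 with h' | h'
    · exact hrev ((sameCycle_sumCongr_inl _ _).1 h').symm
    · exact not_sameCycle_sumCongr _ _ h'
  have m₂ := (cycles_mul_swap hxy').1
  have hn : numCycles Q = numCycles P₁ + numCycles P₂ := numCycles_sumCongr P₁ P₂
  rw [hP₁, hP₂, numCycles_doubled_mul_twisted_option,
    numCycles_doubled_mul_twisted_option] at hn
  have i₁ := isolatedCount_addDart s₁
  have i₂ := isolatedCount_addDart s₂
  have i := isolatedCount_sum (addDart p u) (addDart q v)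
  rw [signedFaceCount, signedFaceCount, signedFaceCount, hP, barVertex, i]
  obtain ⟨N, hN⟩ : ∃ N, N = numCycles (Q * swap (.inl (none, false)) (.inr (none, c)) *
    swap (.inl (none, true)) (.inr (none, !c))) := ⟨_, rfl⟩
  rw [← hN] at m₂ ⊢
  have m : (N : ℝ) + 2 +
        2 * (isolatedCount (addDart p u) + isolatedCount (addDart q v) : ℕ) =
      numCycles (doubled (skipNone e₁) * twisted τ₁ w₁) +
        numCycles (doubled (skipNone e₂) * twisted τ₂ w₂) +
        2 * (isolatedCount p + isolatedCount q : ℕ) := by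
    norm_cast
    omega
  push_cast at m ⊢
  linarith

end Faces

end GraphEmbedding

namespace GraphEmbedding

open MeasureTheory ProbabilityTheory Filter

/-! ### Laws of functions on finite sets -/

section UniformLaw

variable {Ω Ω₁ Ω₂ P : Type*}

/-- The law of `X ω` for a uniform random point `ω` of `Ω`. -/
noncomputable def uniformLaw (X : Ω → ℝ) : Measure ℝ :=
  letI : MeasurableSpace Ω := ⊤
  (uniformOn (Set.univ : Set Ω)).map X

theorem isProbabilityMeasure_uniformLaw [Finite Ω] [Nonempty Ω] (X : Ω → ℝ) :
    IsProbabilityMeasure (uniformLaw X) := by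
  let : MeasurableSpace Ω := ⊤
  have : MeasurableSingletonClass Ω := ⟨fun _ => trivial⟩
  have : IsProbabilityMeasure (uniformOn (Set.univ : Set Ω)) :=
    isProbabilityMeasure_uniformOn Set.finite_univ Set.univ_nonempty
  have hX : Measurable X := measurable_from_top
  exact Measure.isProbabilityMeasure_map hX.aemeasurable

theorem integral_uniformLaw {E : Type*} [NormedAddCommGroup E] [NormedSpace ℝ E]
    [CompleteSpace E] [Fintype Ω]
    (X : Ω → ℝ) {φ : ℝ → E} (hφ : StronglyMeasurable φ) :
    ∫ x, φ x ∂(uniformLaw X) = (Fintype.card Ω : ℝ)⁻¹ • ∑ ω, φ (X ω) := by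
  let : MeasurableSpace Ω := ⊤
  have : MeasurableSingletonClass Ω := ⟨fun _ => trivial⟩
  have hX : Measurable X := measurable_from_top
  change ∫ x, φ x ∂((uniformOn (Set.univ : Set Ω)).map X) = _
  rw [integral_map hX.aemeasurable hφ.aestronglyMeasurable, uniformOn, ProbabilityTheory.cond, Measure.restrict_univ,
    integral_smul_measure, integral_count]
  simp

theorem charFun_uniformLaw [Fintype Ω] (X : Ω → ℝ) (t : ℝ) :
    charFun (uniformLaw X) t =
      (Fintype.card Ω : ℝ)⁻¹ • ∑ ω, Complex.exp (t * X ω * Complex.I) := by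
  rw [charFun_apply_real, integral_uniformLaw X (by fun_prop)]

theorem uniformLaw_congr [Finite Ω₁] [Nonempty Ω₁] {X₁ : Ω₁ → ℝ} {X₂ : Ω₂ → ℝ} (e : Ω₁ ≃ Ω₂)
    (h : ∀ ω, X₂ (e ω) = X₁ ω) : uniformLaw X₁ = uniformLaw X₂ := by
  have := Finite.of_equiv _ e
  have := e.symm.nonempty
  have := Fintype.ofFinite Ω₁
  have := Fintype.ofFinite Ω₂
  have := isProbabilityMeasure_uniformLaw X₁
  have := isProbabilityMeasure_uniformLaw X₂
  refine Measure.ext_of_charFun (funext fun t => ?_)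
  rw [charFun_uniformLaw, charFun_uniformLaw, Fintype.card_congr e, ← e.sum_comp]
  simp only [h]

/-- If the points of `Ω` correspond to triples, and `X` is the sum of a function of the first
coordinate and a function of the second one, then its law is a convolution. -/
theorem uniformLaw_eq_conv [Finite Ω₁] [Finite Ω₂] [Finite P] [Nonempty Ω₁] [Nonempty Ω₂]
    [Nonempty P] {X : Ω → ℝ} {X₁ : Ω₁ → ℝ} {X₂ : Ω₂ → ℝ} (e : Ω ≃ Ω₁ × Ω₂ × P)
    (h : ∀ ω, X ω = X₁ (e ω).1 + X₂ (e ω).2.1) :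
    uniformLaw X = uniformLaw X₁ ∗ uniformLaw X₂ := by
  have := Finite.of_equiv _ e.symm
  have := e.nonempty
  have := Fintype.ofFinite Ω
  have := Fintype.ofFinite Ω₁
  have := Fintype.ofFinite Ω₂
  have := Fintype.ofFinite P
  have := isProbabilityMeasure_uniformLaw X
  have := isProbabilityMeasure_uniformLaw X₁
  have := isProbabilityMeasure_uniformLaw X₂
  refine Measure.ext_of_charFun (funext fun t => ?_)
  rw [charFun_conv, charFun_uniformLaw, charFun_uniformLaw, charFun_uniformLaw,
    Fintype.card_congr e, ← e.symm.sum_comp, Fintype.card_prod, Fintype.card_prod]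
  have hs : ∀ x : Ω₁ × Ω₂ × P, Complex.exp (t * X (e.symm x) * Complex.I) =
      Complex.exp (t * X₁ x.1 * Complex.I) * Complex.exp (t * X₂ x.2.1 * Complex.I) := by
    intro x
    rw [h, Equiv.apply_symm_apply, ← Complex.exp_add]
    congr 1
    push_cast
    ring
  have hP : (Fintype.card P : ℂ) ≠ 0 := Nat.cast_ne_zero.2 Fintype.card_ne_zero
  simp only [hs, Fintype.sum_prod_type, Finset.sum_const, ← Finset.mul_sum, ← Finset.sum_mul,
    Finset.card_univ, nsmul_eq_mul, Complex.real_smul]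
  push_cast
  generalize ∑ ω, Complex.exp (t * X₁ ω * Complex.I) = a
  generalize ∑ ω, Complex.exp (t * X₂ ω * Complex.I) = b
  field_simp

theorem ae_uniformLaw_mem [Finite Ω] (X : Ω → ℝ) {s : Set ℝ} (hs : MeasurableSet s)
    (h : ∀ ω, X ω ∈ s) : ∀ᵐ x ∂(uniformLaw X), x ∈ s := by
  let : MeasurableSpace Ω := ⊤
  have hX : Measurable X := measurable_from_top
  exact (ae_map_iff hX.aemeasurable hs).2 (ae_of_all _ h)

/-- Two values at distance at least `1` contribute at least `1 / 2` to the sum of the squared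
deviations. -/
theorem le_variance_uniformLaw [Fintype Ω] (X : Ω → ℝ) {a b : Ω} (hab : X a + 1 ≤ X b) :
    (2 * Fintype.card Ω : ℝ)⁻¹ ≤ variance id (uniformLaw X) := by
  classical
  set m := ∫ x, id x ∂(uniformLaw X) with hm
  have hv : variance id (uniformLaw X) = (Fintype.card Ω : ℝ)⁻¹ • ∑ ω, (X ω - m) ^ 2 := by
    rw [variance_eq_integral (by fun_prop), ← integral_uniformLaw X
      (φ := fun x => (x - m) ^ 2) (by fun_prop)]
    rfl
  have hne : a ≠ b := by rintro rfl; linarith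
  have h1 : ∑ ω ∈ ({a, b} : Finset Ω), (X ω - m) ^ 2 ≤ ∑ ω, (X ω - m) ^ 2 :=
    Finset.sum_le_sum_of_subset_of_nonneg (Finset.subset_univ _) fun _ _ _ => sq_nonneg _
  rw [Finset.sum_pair hne] at h1
  have h2 : (1 / 2 : ℝ) ≤ ∑ ω, (X ω - m) ^ 2 := by
    nlinarith [sq_nonneg (X a + X b - 2 * m)]
  rw [hv, smul_eq_mul, mul_inv, mul_comm]
  exact mul_le_mul_of_nonneg_left (by simpa using h2) (by positivity)

end UniformLaw

/-! ### Embeddings of isomorphic graphs and of bar-amalgamations -/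

section Transfer

variable {α β α' β' : Type*} {K : Graph α β} {L : Graph α' β'} {A W D : Type*}

/-- An isomorphism from `K` to `L`, together with a labelling of the vertices and edges of `L` and
an orientation of these edges, induces a bijection between the darts. -/
theorem exists_dartEquiv (φ : Iso K L) (η : A ≃ E(L)) (μ : W ≃ V(L)) (ends : A × Bool → W)
    (h : ∀ a, L.IsLink (η a) (μ (ends (a, false))) (μ (ends (a, true)))) :
    ∃ (ψ : Dart K ≃ A × Bool) (ε : E(K) ≃ A) (ν : V(K) ≃ W), (∀ d, (ψ d).1 = ε d.1) ∧
      (∀ d, ψ (dartFlip K d) = ((ψ d).1, !(ψ d).2)) ∧ ∀ d, ends (ψ d) = ν (dartVertex d) := by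
  let ε : E(K) ≃ A := φ.edgeEquiv.trans η.symm
  let ν : V(K) ≃ W := φ.vertexEquiv.trans μ.symm
  -- `c` tells whether the chosen order of the ends of `e` disagrees with the orientation given
  have hc : ∀ e : E(K), ∃ c : Bool, ∀ b, ends (ε e, xor b c) = ν (dartVertex (e, b)) := by
    intro e
    have h1 : L.IsLink (φ.edgeEquiv e) (φ.vertexEquiv (dartVertex (e, false)))
        (φ.vertexEquiv (dartVertex (e, true))) :=
      (φ.isLink_iff e _ _).2 (isLink_firstEnd_secondEnd K e)
    have h2 := h (ε e)
    have h3 : η (ε e) = φ.edgeEquiv e := η.apply_symm_apply _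
    rw [h3] at h2
    have key : ∀ (w : W) (v : V(K)), (μ w : α') = φ.vertexEquiv v → w = ν v := fun w v hw =>
      (Equiv.eq_symm_apply μ).2 (Subtype.ext hw)
    rcases h2.eq_and_eq_or_eq_and_eq h1 with h | h
    · refine ⟨false, fun b => ?_⟩
      cases b
      · exact key _ _ h.1
      · exact key _ _ h.2
    · refine ⟨true, fun b => ?_⟩
      cases b
      · exact key _ _ h.2
      · exact key _ _ h.1
  choose c hc using hc
  let ψ : Dart K ≃ A × Bool :=
    { toFun := fun d => (ε d.1, xor d.2 (c d.1))
      invFun := fun x => (ε.symm x.1, xor x.2 (c (ε.symm x.1)))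
      left_inv := by rintro ⟨e, b⟩; simp
      right_inv := by rintro ⟨a, b⟩; simp }
  refine ⟨ψ, ε, ν, fun _ => rfl, fun d => ?_, fun d => hc d.1 d.2⟩
  obtain ⟨e, b⟩ := d
  simp [ψ, dartFlip]

theorem isolatedCount_congr {p : D → W} (ψ : Dart K ≃ D) (ν : V(K) ≃ W)
    (hp : ∀ d, p (ψ d) = ν (dartVertex d)) : numIsolated K = isolatedCount p := by
  refine Nat.card_congr (ν.subtypeEquiv fun v => ?_)
  rw [← ψ.forall_congr_right (q := fun d => p d ≠ ν v)]
  simp [hp]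

/-- The genus law of `K`, computed from a labelling of its darts and vertices. -/
theorem genusLaw_eq [Finite E(K)] {p : D → W} {τ : Equiv.Perm D} (ψ : Dart K ≃ D)
    (ν : V(K) ≃ W) (hp : ∀ d, p (ψ d) = ν (dartVertex d))
    (hτ : ∀ d, ψ (dartFlip K d) = τ (ψ d)) :
    genusLaw K = uniformLaw fun R : Rotation p =>
      (2 - ((Nat.card W : ℝ) - Nat.card E(K) + faceCount p τ R.1)) / 2 := by
  let e : Rotation (dartVertex (G := K)) ≃ Rotation p := rotationCongr ψ ν ν.injective hp
  refine uniformLaw_congr (Ω₁ := Rotation (dartVertex (G := K))) e fun R => ?_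
  have hn : numCycles (R.1 * dartFlip K) = numCycles ((e R).1 * τ) :=
    numCycles_congr ψ fun d => by
      rw [Equiv.Perm.mul_apply, Equiv.Perm.mul_apply, ← hτ, rotationCongr_apply]
  have hf : (RotationSystem.numFaces (G := K) R) = faceCount p τ (e R).1 := by
    change numCycles (R.1 * dartFlip K) + numIsolated K = _
    rw [faceCount, ← hn, isolatedCount_congr ψ ν hp]
  change _ = (2 - ((Nat.card V(K) : ℝ) - Nat.card E(K) +
    RotationSystem.numFaces (G := K) R)) / 2
  rw [hf, Nat.card_congr ν]

/-- The Euler-genus law of `K`, computed from a labelling of its darts, edges and vertices. -/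
theorem eulerGenusLaw_eq [Finite E(K)] {p : D → W} {τ : Equiv.Perm D} (ψ : Dart K ≃ D)
    (ν : V(K) ≃ W) (ε : E(K) ≃ A) (a : D → A) (hp : ∀ d, p (ψ d) = ν (dartVertex d))
    (hτ : ∀ d, ψ (dartFlip K d) = τ (ψ d)) (ha : ∀ d, a (ψ d) = ε d.1) :
    eulerGenusLaw K = uniformLaw fun S : Rotation p × (A → Bool) =>
      2 - ((Nat.card W : ℝ) - Nat.card E(K) + signedFaceCount p τ (fun d => S.2 (a d)) S.1.1) := by
  let r : Rotation (dartVertex (G := K)) ≃ Rotation p := rotationCongr ψ ν ν.injective hp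
  let e : Rotation (dartVertex (G := K)) × (E(K) → Bool) ≃ Rotation p × (A → Bool) :=
    r.prodCongr (ε.arrowCongr (Equiv.refl Bool))
  refine uniformLaw_congr (Ω₁ := Rotation (dartVertex (G := K)) × (E(K) → Bool)) e fun S => ?_
  have hr : ∀ d, (r S.1).1 (ψ d) = ψ (S.1.1 d) := rotationCongr_apply ψ ν ν.injective hp S.1
  have hr' : ∀ d, (r S.1).1.symm (ψ d) = ψ (S.1.1.symm d) := fun d => by
    rw [Equiv.symm_apply_eq, hr, Equiv.apply_symm_apply]
  have hn : numCycles (SignedRotationSystem.sigma (G := K) S * SignedRotationSystem.tau (G := K) S)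
      = numCycles (doubled (e S).1.1 * twisted τ fun d => (e S).2 (a d)) := by
    refine numCycles_congr (ψ.prodCongr (Equiv.refl Bool)) ?_
    have h1 : ∀ x, (ψ.prodCongr (Equiv.refl Bool)) (SignedRotationSystem.sigma (G := K) S x) =
        doubled (r S.1).1 ((ψ.prodCongr (Equiv.refl Bool)) x) := by
      rintro ⟨d, _ | _⟩
      · exact Prod.ext (hr d).symm rfl
      · exact Prod.ext (hr' d).symm rfl
    rintro ⟨d, s⟩
    rw [Equiv.Perm.mul_apply, h1, Equiv.Perm.mul_apply]
    refine congrArg _ (Prod.ext (hτ d) ?_)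
    change xor s (S.2 d.1) = xor s (S.2 (ε.symm (a (ψ d))))
    rw [ha, Equiv.symm_apply_apply]
  have hf : SignedRotationSystem.numFaces (G := K) S =
      signedFaceCount p τ (fun d => (e S).2 (a d)) (e S).1.1 := by
    change (numCycles (SignedRotationSystem.sigma (G := K) S *
      SignedRotationSystem.tau (G := K) S) : ℝ) / 2 + numIsolated K = _
    rw [signedFaceCount, ← hn, isolatedCount_congr ψ ν hp]
  change _ = 2 - ((Nat.card V(K) : ℝ) - Nat.card E(K) +
    SignedRotationSystem.numFaces (G := K) S)
  rw [hf, Nat.card_congr ν]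

/-- The laws of isomorphic graphs agree, as they do not depend on the labelling of the darts. -/
theorem laws_of_iso (φ : Iso K L) [Finite E(L)] :
    genusLaw K = genusLaw L ∧ eulerGenusLaw K = eulerGenusLaw L := by
  have : Finite E(K) := Finite.of_equiv _ φ.edgeEquiv.symm
  obtain ⟨ψ, ε, ν, h₁, h₂, h₃⟩ := exists_dartEquiv φ (Equiv.refl _) (Equiv.refl _) dartVertex
    fun e => isLink_firstEnd_secondEnd L e
  have h₂' : ∀ d, ψ (dartFlip K d) = dartFlip L (ψ d) := h₂
  have hE : Nat.card E(K) = Nat.card E(L) := Nat.card_congr φ.edgeEquiv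
  rw [genusLaw_eq (p := dartVertex) ψ ν h₃ h₂',
    eulerGenusLaw_eq (p := dartVertex) ψ ν ε Prod.fst h₃ h₂' h₁, hE]
  exact ⟨rfl, rfl⟩

end Transfer

section Bar

variable {α β α' β' : Type*} {G : Graph α β} {H : Graph α' β'}

/-- The edges of a bar-amalgamation. -/
noncomputable def barEdgeEquiv (u : V(G)) (v : V(H)) :
    Option (E(G) ⊕ E(H)) ≃ E(barAmalgamation G H u v) := by
  have hm : ∀ {e x y}, barLink G H u v e x y → e ∈ E(barAmalgamation G H u v) :=
    fun {e x y} h => Graph.IsLink.edge_mem (G := barAmalgamation G H u v) (x := x) (y := y) h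
  refine Equiv.ofBijective (fun a => ⟨a.map (Sum.map Subtype.val Subtype.val), ?_⟩) ⟨?_, ?_⟩
  · rcases a with _ | e | e
    · exact hm (x := .inl u) (y := .inr v) ⟨rfl, rfl⟩
    · exact hm (x := .inl _) (y := .inl _) (isLink_firstEnd_secondEnd G e)
    · exact hm (x := .inr _) (y := .inr _) (isLink_firstEnd_secondEnd H e)
  · intro a b h
    exact Option.map_injective (Sum.map_injective.2 ⟨Subtype.val_injective, Subtype.val_injective⟩)
      (congrArg Subtype.val h)
  · rintro ⟨e, he⟩
    obtain ⟨x, y, hl⟩ := Graph.exists_isLink_of_mem_edgeSet he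
    change barLink G H u v e x y at hl
    rcases e with _ | e | e
    · exact ⟨none, rfl⟩
    · rcases x with x | x <;> rcases y with y | y <;> simp only [barLink] at hl
      exact ⟨some (.inl ⟨e, hl.edge_mem⟩), rfl⟩
    · rcases x with x | x <;> rcases y with y | y <;> simp only [barLink] at hl
      exact ⟨some (.inr ⟨e, hl.edge_mem⟩), rfl⟩

/-- The vertices of a bar-amalgamation. -/
noncomputable def barVertexEquiv (u : V(G)) (v : V(H)) :
    V(G) ⊕ V(H) ≃ V(barAmalgamation G H u v) := by
  refine Equiv.ofBijective (fun x => ⟨x.map Subtype.val Subtype.val, ?_⟩) ⟨?_, ?_⟩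
  · rcases x with x | x
    · exact Or.inl ⟨x, x.2, rfl⟩
    · exact Or.inr ⟨x, x.2, rfl⟩
  · intro a b h
    exact Sum.map_injective.2 ⟨Subtype.val_injective, Subtype.val_injective⟩
      (congrArg Subtype.val h)
  · rintro ⟨_, ⟨x, hx, rfl⟩ | ⟨x, hx, rfl⟩⟩
    · exact ⟨.inl ⟨x, hx⟩, rfl⟩
    · exact ⟨.inr ⟨x, hx⟩, rfl⟩

/-- The darts of a bar-amalgamation; the new edge is oriented from `G` to `H`. -/
def barDartEquiv (A B : Type*) :
    Option (A ⊕ B) × Bool ≃ BarDart (A × Bool) (B × Bool) where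
  toFun
    | (none, false) => .inl none
    | (none, true) => .inr none
    | (some (.inl e), b) => .inl (some (e, b))
    | (some (.inr e), b) => .inr (some (e, b))
  invFun
    | .inl none => (none, false)
    | .inr none => (none, true)
    | .inl (some x) => (some (.inl x.1), x.2)
    | .inr (some x) => (some (.inr x.1), x.2)
  left_inv := by rintro ⟨_ | e | e, _ | _⟩ <;> rfl
  right_inv := by rintro ((_ | ⟨e, b⟩) | (_ | ⟨e, b⟩)) <;> rfl

/-- The edge of a dart of a bar-amalgamation. -/
def barEdge {A B : Type*} : BarDart (A × Bool) (B × Bool) → Option (A ⊕ B) :=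
  Sum.elim (fun o => o.map fun x => .inl x.1) fun o => o.map fun x => .inr x.1

theorem barEdge_barDartEquiv {A B : Type*} (x : Option (A ⊕ B) × Bool) :
    barEdge (barDartEquiv A B x) = x.1 := by
  rcases x with ⟨_ | e | e, _ | _⟩ <;> rfl

theorem barFlip_barDartEquiv (x : Option (E(G) ⊕ E(H)) × Bool) :
    barFlip (dartFlip G) (dartFlip H) (barDartEquiv _ _ x) = barDartEquiv _ _ (x.1, !x.2) := by
  rcases x with ⟨_ | e | e, _ | _⟩ <;>
    simp [barFlip, barDartEquiv, dartFlip, Equiv.swap_apply_def]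

/-- Both laws of a bar-amalgamation are convolutions. -/
theorem laws_of_bar {α'' β'' : Type*} {K : Graph α'' β''} {u : V(G)} {v : V(H)}
    (φ : Iso K (barAmalgamation G H u v)) [Finite V(G)] [Finite V(H)] [Finite E(G)]
    [Finite E(H)] :
    genusLaw K = genusLaw G ∗ genusLaw H ∧
      eulerGenusLaw K = eulerGenusLaw G ∗ eulerGenusLaw H := by
  let p₁ : Dart G → V(G) := dartVertex
  let p₂ : Dart H → V(H) := dartVertex
  let κ := barDartEquiv E(G) E(H)
  obtain ⟨ψ, ε, ν, h₁, h₂, h₃⟩ := exists_dartEquiv φ (barEdgeEquiv u v) (barVertexEquiv u v)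
    (fun x => barVertex p₁ p₂ u v (κ x)) (by
      rintro (_ | e | e)
      · exact ⟨rfl, rfl⟩
      · exact isLink_firstEnd_secondEnd G e
      · exact isLink_firstEnd_secondEnd H e)
  have : Finite E(K) := Finite.of_equiv _ ε.symm
  have hτ : ∀ d, (ψ.trans κ) (dartFlip K d) =
      barFlip (dartFlip G) (dartFlip H) ((ψ.trans κ) d) := fun d => by
    rw [Equiv.trans_apply, Equiv.trans_apply, barFlip_barDartEquiv, h₂]
  have ha : ∀ d, barEdge ((ψ.trans κ) d) = ε d.1 := fun d => by
    rw [Equiv.trans_apply, barEdge_barDartEquiv, h₁]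
  have hV : (Nat.card (V(G) ⊕ V(H)) : ℝ) = Nat.card V(G) + Nat.card V(H) := by
    rw [Nat.card_sum]; push_cast; rfl
  have hE : (Nat.card E(K) : ℝ) = Nat.card E(G) + Nat.card E(H) + 1 := by
    rw [Nat.card_congr ε, Finite.card_option, Nat.card_sum]; push_cast; rfl
  have : Nonempty ({o // IsSlot p₁ u o} × {o // IsSlot p₂ v o}) :=
    ⟨⟨_, (exists_isSlot p₁ u).choose_spec⟩, ⟨_, (exists_isSlot p₂ v).choose_spec⟩⟩
  constructor
  · rw [genusLaw_eq (p := barVertex p₁ p₂ u v) (ψ.trans κ) ν h₃ hτ]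
    refine uniformLaw_eq_conv (Ω₁ := Rotation p₁) (Ω₂ := Rotation p₂) (rotationBar p₁ p₂ u v)
      fun R => ?_
    have hF : (faceCount (barVertex p₁ p₂ u v) (barFlip (dartFlip G) (dartFlip H)) R.1 : ℝ) + 1 =
        faceCount p₁ (dartFlip G) (rotationBar p₁ p₂ u v R).1.1 +
          faceCount p₂ (dartFlip H) (rotationBar p₁ p₂ u v R).2.1.1 :=
      mod_cast faceCount_bar (dartFlip G) (dartFlip H) R
    change _ = (2 - ((Nat.card V(G) : ℝ) - Nat.card E(G) +
        faceCount p₁ (dartFlip G) (rotationBar p₁ p₂ u v R).1.1)) / 2 +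
      (2 - ((Nat.card V(H) : ℝ) - Nat.card E(H) +
        faceCount p₂ (dartFlip H) (rotationBar p₁ p₂ u v R).2.1.1)) / 2
    rw [hV, hE]
    linarith
  · rw [eulerGenusLaw_eq (p := barVertex p₁ p₂ u v) (ψ.trans κ) ν ε barEdge h₃ hτ ha]
    let θ : (Option (E(G) ⊕ E(H)) → Bool) ≃ (E(G) → Bool) × (E(H) → Bool) × Bool :=
      { toFun := fun t => (fun e => t (some (.inl e)), fun e => t (some (.inr e)), t none)
        invFun := fun t o => o.elim t.2.2 (Sum.elim t.1 t.2.1)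
        left_inv := fun t => by funext o; rcases o with _ | e | e <;> rfl
        right_inv := fun _ => rfl }
    let Θ : Rotation (barVertex p₁ p₂ u v) × (Option (E(G) ⊕ E(H)) → Bool) ≃
        (Rotation p₁ × (E(G) → Bool)) × (Rotation p₂ × (E(H) → Bool)) ×
          (({o // IsSlot p₁ u o} × {o // IsSlot p₂ v o}) × Bool) :=
      ((rotationBar p₁ p₂ u v).prodCongr θ).trans
        { toFun := fun x => ((x.1.1, x.2.1), (x.1.2.1, x.2.2.1), (x.1.2.2, x.2.2.2))
          invFun := fun x => ((x.1.1, x.2.1.1, x.2.2.1), (x.1.2, x.2.1.2, x.2.2.2))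
          left_inv := fun _ => rfl
          right_inv := fun _ => rfl }
    refine uniformLaw_eq_conv (Ω₁ := Rotation p₁ × (E(G) → Bool))
      (Ω₂ := Rotation p₂ × (E(H) → Bool)) Θ fun S => ?_
    obtain ⟨R, t⟩ := S
    let w₁ : Dart G → Bool := fun d => t (some (.inl d.1))
    let w₂ : Dart H → Bool := fun d => t (some (.inr d.1))
    have hw : (fun d => t (barEdge d)) = barTwist w₁ w₂ (t none) := by
      funext d
      rcases d with (_ | d) | (_ | d) <;> rfl
    have hF := signedFaceCount_bar (τ₁ := dartFlip G) (w₁ := w₁) (dartFlip H) w₂ (t none)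
      (by rintro ⟨e, b⟩; simp [dartFlip]) (by rintro ⟨e, b⟩; simp [dartFlip])
      (by rintro ⟨e, b⟩; rfl) R
    rw [← hw] at hF
    have e₁ : SignedRotationSystem.eulerGenus (G := G) ((rotationBar p₁ p₂ u v R).1, (θ t).1) =
        2 - ((Nat.card V(G) : ℝ) - Nat.card E(G) +
          signedFaceCount p₁ (dartFlip G) w₁ (rotationBar p₁ p₂ u v R).1.1) := rfl
    have e₂ : SignedRotationSystem.eulerGenus (G := H) ((rotationBar p₁ p₂ u v R).2.1, (θ t).2.1) =
        2 - ((Nat.card V(H) : ℝ) - Nat.card E(H) +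
          signedFaceCount p₂ (dartFlip H) w₂ (rotationBar p₁ p₂ u v R).2.1.1) := rfl
    refine Eq.trans ?_ (congrArg₂ (· + ·) e₁ e₂).symm
    change 2 - ((Nat.card (V(G) ⊕ V(H)) : ℝ) - Nat.card E(K) + signedFaceCount
      (barVertex p₁ p₂ u v) (barFlip (dartFlip G) (dartFlip H)) (fun d => t (barEdge d)) R.1) = _
    rw [hV, hE]
    linarith

end Bar

end GraphEmbedding

namespace GraphEmbedding

open MeasureTheory ProbabilityTheory Filter

/-! ### Bounds depending only on the number of edges -/

section Bounds

variable {α β : Type*} {G : Graph α β}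

instance (G : Graph α β) [Finite E(G)] : Finite (RotationSystem G) :=
  inferInstanceAs (Finite (Rotation (dartVertex (G := G))))

instance (G : Graph α β) [Finite E(G)] : Nonempty (RotationSystem G) :=
  inferInstanceAs (Nonempty (Rotation (dartVertex (G := G))))

instance (G : Graph α β) [Finite E(G)] : Finite (SignedRotationSystem G) :=
  inferInstanceAs (Finite (RotationSystem G × (E(G) → Bool)))

instance (G : Graph α β) [Finite E(G)] : Nonempty (SignedRotationSystem G) :=
  inferInstanceAs (Nonempty (RotationSystem G × (E(G) → Bool)))

theorem card_dart [Finite E(G)] : Nat.card (Dart G) = 2 * Nat.card E(G) := by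
  rw [Nat.card_prod, Nat.card_eq_fintype_card (α := Bool), Fintype.card_bool, mul_comm]

/-- The genera of the rotation systems lie in an interval of bounded length, since only the number
of cycles varies, and it is at most the number of darts. -/
theorem exists_genus_mem_Icc [Finite E(G)] {M : ℕ} (hM : Nat.card E(G) ≤ M) :
    ∃ a : ℝ, ∀ R : RotationSystem G, R.genus ∈ Set.Icc a (a + 2 * M) := by
  refine ⟨(2 - ((Nat.card V(G) : ℝ) - Nat.card E(G) + numIsolated G)) / 2 - M, fun R => ?_⟩
  have h1 : (numCycles (R.1 * dartFlip G) : ℝ) ≤ 2 * M := by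
    have := numCycles_le_card (R.1 * dartFlip G)
    rw [card_dart] at this
    exact_mod_cast this.trans (Nat.mul_le_mul_left 2 hM)
  have h2 : (0 : ℝ) ≤ numCycles (R.1 * dartFlip G) := Nat.cast_nonneg _
  have h3 : (0 : ℝ) ≤ M := Nat.cast_nonneg _
  simp only [RotationSystem.genus, RotationSystem.numFaces]
  push_cast
  constructor <;> linarith

/-- The signed version: there are at most `4 M` cycles, as every dart has two signs. -/
theorem exists_eulerGenus_mem_Icc [Finite E(G)] {M : ℕ} (hM : Nat.card E(G) ≤ M) :
    ∃ a : ℝ, ∀ S : SignedRotationSystem G, S.eulerGenus ∈ Set.Icc a (a + 2 * M) := by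
  refine ⟨2 - ((Nat.card V(G) : ℝ) - Nat.card E(G) + numIsolated G) - 2 * M, fun S => ?_⟩
  have h1 : (numCycles (S.sigma * S.tau) : ℝ) ≤ 4 * M := by
    have := numCycles_le_card (S.sigma * S.tau)
    rw [Nat.card_prod, card_dart, Nat.card_eq_fintype_card (α := Bool), Fintype.card_bool] at this
    have h : numCycles (S.sigma * S.tau) ≤ 4 * M := by omega
    exact_mod_cast h
  have h2 : (0 : ℝ) ≤ numCycles (S.sigma * S.tau) := Nat.cast_nonneg _
  simp only [SignedRotationSystem.eulerGenus, SignedRotationSystem.numFaces]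
  constructor <;> linarith

theorem card_rotationSystem_le [Finite E(G)] {M : ℕ} (hM : Nat.card E(G) ≤ M) :
    Nat.card (RotationSystem G) ≤ (2 * M).factorial := by
  have h := Nat.card_le_card_of_injective
    (fun R : RotationSystem G => (R.1 : Equiv.Perm (Dart G))) Subtype.val_injective
  rw [Nat.card_perm, card_dart] at h
  exact h.trans (Nat.factorial_le (Nat.mul_le_mul_left 2 hM))

theorem card_signedRotationSystem_le [Finite E(G)] {M : ℕ} (hM : Nat.card E(G) ≤ M) :
    Nat.card (SignedRotationSystem G) ≤ (2 * M).factorial * 2 ^ M := by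
  have h : Nat.card (SignedRotationSystem G) =
      Nat.card (RotationSystem G) * Nat.card (E(G) → Bool) := Nat.card_prod _ _
  rw [h, Nat.card_fun, Nat.card_eq_fintype_card (α := Bool), Fintype.card_bool]
  exact Nat.mul_le_mul (card_rotationSystem_le hM) (Nat.pow_le_pow_right two_pos hM)

/-- If the least natural value of `X` is smaller than the greatest one, then two values of `X`
differ by at least `1`. The junk value `0` of the supremum of the empty set or of an unbounded
set is excluded by the strict inequality. -/
theorem exists_add_one_le_of_sInf_lt_sSup {Ω : Type*} (X : Ω → ℝ)
    (h : sInf {i : ℕ | ∃ ω, X ω = i} < sSup {i : ℕ | ∃ ω, X ω = i}) :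
    ∃ a b, X a + 1 ≤ X b := by
  set s := {i : ℕ | ∃ ω, X ω = i} with hs
  have hne : s.Nonempty := by
    by_contra he
    rw [Set.not_nonempty_iff_eq_empty] at he
    simp [he] at h
  have hb : BddAbove s := by
    by_contra hb
    rw [Nat.sSup_of_not_bddAbove hb] at h
    exact Nat.not_lt_zero _ h
  obtain ⟨a, ha⟩ := Nat.sInf_mem hne
  obtain ⟨b, hb⟩ := Nat.sSup_mem hne hb
  refine ⟨a, b, ?_⟩
  rw [ha, hb]
  exact_mod_cast h

theorem le_variance_of_card_le {Ω : Type*} [Finite Ω] [Nonempty Ω] (X : Ω → ℝ) {N : ℕ}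
    (hN : Nat.card Ω ≤ N)
    (h : sInf {i : ℕ | ∃ ω, X ω = i} < sSup {i : ℕ | ∃ ω, X ω = i}) :
    (2 * N : ℝ)⁻¹ ≤ variance id (uniformLaw X) := by
  have := Fintype.ofFinite Ω
  obtain ⟨a, b, hab⟩ := exists_add_one_le_of_sInf_lt_sSup X h
  rw [Nat.card_eq_fintype_card] at hN
  refine le_trans ?_ (le_variance_uniformLaw X hab)
  have : 0 < Fintype.card Ω := Fintype.card_pos
  gcongr

/-- The partial sums of nonnegative terms, infinitely many of which are at least `δ`, diverge. -/
theorem tendsto_sum_range_of_infinite {f : ℕ → ℝ} (hf : ∀ n, 0 ≤ f n) {δ : ℝ} (hδ : 0 < δ)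
    {s : Set ℕ} (hs : s.Infinite) (h : ∀ n ∈ s, δ ≤ f n) :
    Tendsto (fun n => ∑ k ∈ Finset.range (n + 1), f k) atTop atTop := by
  have hns : ¬ Summable f := fun hsum => by
    have h1 := hsum.tendsto_atTop_zero.eventually_lt_const hδ
    obtain ⟨n, hn, hn'⟩ := ((Nat.frequently_atTop_iff_infinite.2 hs).and_eventually h1).exists
    exact absurd hn' (not_lt.2 (h n hn))
  exact ((not_summable_iff_tendsto_nat_atTop_of_nonneg hf).1 hns).comp (tendsto_add_atTop_nat 1)

end Bounds

/-! ### Tree-like sequences -/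

section TreeLike

variable {α β α' β' : Type*} {H : ℕ → Graph α β} {G : ℕ → Graph α' β'}

theorem finite_of_isTreeLikeSequence (hV : ∀ n, Finite V(H n)) (hE : ∀ n, Finite E(H n))
    (hG : IsTreeLikeSequence H G) (n : ℕ) : Finite V(G n) ∧ Finite E(G n) := by
  induction n with
  | zero =>
    obtain ⟨φ⟩ := hG.1
    exact ⟨Finite.of_equiv _ φ.vertexEquiv.symm, Finite.of_equiv _ φ.edgeEquiv.symm⟩
  | succ n ih =>
    obtain ⟨h1, h2⟩ := ih
    obtain ⟨u, v, ⟨φ⟩⟩ := hG.2 n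
    have := Finite.of_equiv _ (barVertexEquiv u v)
    have := Finite.of_equiv _ (barEdgeEquiv u v)
    exact ⟨Finite.of_equiv _ φ.vertexEquiv.symm, Finite.of_equiv _ φ.edgeEquiv.symm⟩

/-- The laws of a tree-like sequence are the iterated convolutions of the laws of its parts. -/
theorem laws_of_isTreeLikeSequence (hV : ∀ n, Finite V(H n)) (hE : ∀ n, Finite E(H n))
    (hG : IsTreeLikeSequence H G) :
    (genusLaw (G 0) = genusLaw (H 0) ∧ eulerGenusLaw (G 0) = eulerGenusLaw (H 0)) ∧
      ∀ n, genusLaw (G (n + 1)) = genusLaw (G n) ∗ genusLaw (H (n + 1)) ∧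
        eulerGenusLaw (G (n + 1)) = eulerGenusLaw (G n) ∗ eulerGenusLaw (H (n + 1)) := by
  refine ⟨?_, fun n => ?_⟩
  · obtain ⟨φ⟩ := hG.1
    exact laws_of_iso φ
  · obtain ⟨h1, h2⟩ := finite_of_isTreeLikeSequence hV hE hG n
    obtain ⟨u, v, ⟨φ⟩⟩ := hG.2 n
    exact laws_of_bar φ

/-- Iterated convolutions of uniform laws on sets of bounded size, carried by intervals of a
bounded length, are asymptotically normal if infinitely many of them take two different natural
values. -/
theorem asymptoticallyNormal_of_uniformLaw {Ω : ℕ → Type*} [∀ n, Finite (Ω n)]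
    [∀ n, Nonempty (Ω n)] (X : ∀ n, Ω n → ℝ) {μ : ℕ → Measure ℝ} {C : ℝ} (hC : 0 ≤ C) {N : ℕ}
    (hN : ∀ n, Nat.card (Ω n) ≤ N) (hX : ∀ n, ∃ a, ∀ ω, X n ω ∈ Set.Icc a (a + C))
    (h0 : μ 0 = uniformLaw (X 0)) (hs : ∀ n, μ (n + 1) = μ n ∗ uniformLaw (X (n + 1)))
    (hinf : {n | sInf {i : ℕ | ∃ ω, X n ω = i} < sSup {i : ℕ | ∃ ω, X n ω = i}}.Infinite) :
    AsymptoticallyNormal μ := by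
  have := fun n => isProbabilityMeasure_uniformLaw (X n)
  have hN0 : 0 < N := Nat.card_pos.trans_le (hN 0)
  refine asymptoticallyNormal_of_conv (ν := fun n => uniformLaw (X n)) hC (fun n => ?_) h0 hs ?_
  · obtain ⟨a, ha⟩ := hX n
    exact ⟨a, ae_uniformLaw_mem (X n) measurableSet_Icc ha⟩
  · exact tendsto_sum_range_of_infinite (fun n => variance_nonneg _ _)
      (δ := (2 * N : ℝ)⁻¹) (by positivity) hinf fun n hn => le_variance_of_card_le (X n) (hN n) hn

end TreeLike

end GraphEmbedding

theorem mainTheorem2 {α β α' β' : Type*} (H : ℕ → Graph α β) (G : ℕ → Graph α' β')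
    (hfin : ∀ n, V(H n).Finite) (hconn : ∀ n, GraphEmbedding.Connected (H n))
    (M : ℕ) (hM : ∀ n, E(H n).encard ≤ M)
    (hG : GraphEmbedding.IsTreeLikeSequence H G) :
    ({n | GraphEmbedding.minGenus (H n) < GraphEmbedding.maxGenus (H n)}.Infinite →
      GraphEmbedding.AsymptoticallyNormal fun n => GraphEmbedding.genusLaw (G n)) ∧
    ({n | GraphEmbedding.minEulerGenus (H n) < GraphEmbedding.maxEulerGenus (H n)}.Infinite →
      GraphEmbedding.AsymptoticallyNormal fun n => GraphEmbedding.eulerGenusLaw (G n)) := by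
  have hV : ∀ n, Finite V(H n) := fun n => (hfin n).to_subtype
  have hE : ∀ n, Finite E(H n) := fun n => (Set.finite_of_encard_le_coe (hM n)).to_subtype
  have hM' : ∀ n, Nat.card E(H n) ≤ M := fun n => by
    have h := hM n
    rw [← (Set.finite_of_encard_le_coe h).cast_ncard_eq] at h
    exact_mod_cast h
  obtain ⟨⟨g0, e0⟩, hs⟩ := GraphEmbedding.laws_of_isTreeLikeSequence hV hE hG
  have hC : (0 : ℝ) ≤ 2 * M := by positivity
  constructor
  · exact GraphEmbedding.asymptoticallyNormal_of_uniformLaw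
      (fun n => GraphEmbedding.RotationSystem.genus (G := H n)) hC
      (fun n => GraphEmbedding.card_rotationSystem_le (hM' n))
      (fun n => GraphEmbedding.exists_genus_mem_Icc (hM' n)) g0 fun n => (hs n).1
  · exact GraphEmbedding.asymptoticallyNormal_of_uniformLaw
      (fun n => GraphEmbedding.SignedRotationSystem.eulerGenus (G := H n)) hC
      (fun n => GraphEmbedding.card_signedRotationSystem_le (hM' n))
      (fun n => GraphEmbedding.exists_eulerGenus_mem_Icc (hM' n)) e0 fun n => (hs n).2
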